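/- All manifolds, metrics, maps and tensor fields are smooth. Let $(M^2,g)$ be a Riemannian surface with Levi-Civita connection $\nabla$ and Gaussian curvature $K$. Let $\{X_1,X_2\}$ denote a local orthonormal frame, let $\Delta f=-\operatorname{div}(\operatorname{grad} f)$ be the Laplacian on functions, and for tensor fields $T,S$ of type $(1,1)$ put $\langle T,S\rangle=\sum_i\langle T(X_i),S(X_i)\rangle$, $|T|^2=\langle T,T\rangle$, $\operatorname{div}T=\sum_i(\nabla_{X_i}T)(X_i)$, $|\nabla T|^2=\sum_i|\nabla_{X_i}T|^2$ and $\operatorname{trace}\nabla^2T=\sum_i(\nabla^2T)(X_i,X_i,\cdot)$. (1) Let $T$ be a symmetric tensor field of type $(1,1)$ on $M$ with $\operatorname{div}T=0$, and let $t=\operatorname{trace}T$. Then $$\operatorname{trace}(\nabla^2T)=2KT-tK\,I-(\Delta t)\,I-\nabla\operatorname{grad}t .$$ (2) Let $(N^n,h)$ be a Riemannian manifold and $\varphi:(M^2,g)\to(N^n,h)$ a Riemannian (that is, isometric) immersion with tension field $\tau(\varphi)=\operatorname{trace}\nabla d\varphi$. Its stress-bienergy tensor $S_2$ is the symmetric tensor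 field of type $(1,1)$ on $M$ given by $$\langle S_2(X),Y\rangle=\tfrac12|\tau(\varphi)|^2\langle X,Y\rangle+\langle d\varphi,\nabla\tau(\varphi)\rangle\langle X,Y\rangle-\langle d\varphi(X),\nabla_Y\tau(\varphi)\rangle-\langle d\varphi(Y),\nabla_X\tau(\varphi)\rangle ,$$ where $\nabla\tau(\varphi)$ is taken with respect to the pull-back to $\varphi^{-1}(TN)$ of the Levi-Civita connection of $N$, and $\langle d\varphi,\nabla\tau(\varphi)\rangle=\sum_i\langle d\varphi(X_i),\nabla_{X_i}\tau(\varphi)\rangle$. Suppose that $\varphi$ is biconservative, i.e. $\operatorname{div}S_2=0$. Then $$\tfrac12\Delta|S_2|^2=-2K|S_2|^2+\operatorname{div}\big(\langle S_2,\operatorname{grad}(|\tau(\varphi)|^2)\rangle^\sharp\big)+K|\tau(\varphi)|^4+\tfrac12\Delta\big(|\tau(\varphi)|^4\big)+\big|\operatorname{grad}(|\tau(\varphi)|^2)\big|^2-|\nabla S_2|^2 ,$$ where $\langle S_2,Z\rangle$ is the one-form $X\mapsto\langle S_2(X),Z\rangle$ and $\sharp$ denotes the dual vector field. -/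

import Mathlib

open scoped Manifold ContDiff Matrix
open Bundle

noncomputable section

namespace Biconservative

/-! ### Riemannian geometry in local coordinates

Throughout, `G : ℝᵐ → Matrix` is the matrix `g_{ij}` of a Riemannian metric in a chart, `∂_i` is the
`i`-th coordinate vector field, vector fields are given by their components `X^k`, and a tensor
field `T` of type `(1,1)` by the matrix `T k j = T^k_j` with `T(∂_j) = ∑ k, T^k_j ∂_k`. -/

/-- The model space `ℝᵐ` of a chart. -/
abbrev Coord (m : ℕ) : Type := EuclideanSpace ℝ (Fin m)

/-- A field of `m × m` matrices on the model space. -/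
abbrev MatrixField (m : ℕ) : Type := Coord m → Matrix (Fin m) (Fin m) ℝ

/-- The partial derivative `∂_i f`. -/
def pd {m : ℕ} (i : Fin m) (f : Coord m → ℝ) (y : Coord m) : ℝ :=
  fderiv ℝ f y (EuclideanSpace.single i 1)

/-- The Christoffel symbol `Γ^k_{ij}` of the Levi-Civita connection:
`∇_{∂_i} ∂_j = ∑ k, Γ^k_{ij} ∂_k`. -/
def christoffel {m : ℕ} (G : MatrixField m) (k i j : Fin m) (y : Coord m) : ℝ :=
  (1 / 2) * ∑ l, (G y)⁻¹ k l *
    (pd i (fun z => G z j l) y + pd j (fun z => G z i l) y - pd l (fun z => G z i j) y)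

/-- The component `l` of `R(∂_i, ∂_j) ∂_k`, where
`R(U,V)W = ∇_U ∇_V W - ∇_V ∇_U W - ∇_{[U,V]} W`. -/
def riemann {m : ℕ} (G : MatrixField m) (l k i j : Fin m) (y : Coord m) : ℝ :=
  pd i (christoffel G l j k) y - pd j (christoffel G l i k) y
    + ∑ p, (christoffel G l i p y * christoffel G p j k y
      - christoffel G l j p y * christoffel G p i k y)

/-- The Gaussian curvature of a surface,
`K = ⟨R(∂_0, ∂_1) ∂_1, ∂_0⟩ / (|∂_0|² |∂_1|² - ⟨∂_0, ∂_1⟩²)`. -/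
def gaussCurvature (G : MatrixField 2) (y : Coord 2) : ℝ :=
  (∑ l, G y l 0 * riemann G l 1 0 1 y) / (G y).det

/-- The gradient of a function, `(grad f)^k = ∑ j, g^{kj} ∂_j f`. -/
def grad {m : ℕ} (G : MatrixField m) (f : Coord m → ℝ) (y : Coord m) (k : Fin m) : ℝ :=
  ∑ j, (G y)⁻¹ k j * pd j f y

/-- The squared length `|X|²` of a vector with components `X`. -/
def vecNormSq {m : ℕ} (G : MatrixField m) (y : Coord m) (X : Fin m → ℝ) : ℝ :=
  ∑ i, ∑ j, G y i j * X i * X j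

/-- The component `k` of `∇_{∂_i} X`, for a vector field `X`. -/
def covVec {m : ℕ} (G : MatrixField m) (X : Coord m → Fin m → ℝ) (i k : Fin m) (y : Coord m) : ℝ :=
  pd i (fun z => X z k) y + ∑ p, christoffel G k i p y * X y p

/-- The divergence of a vector field, the trace of `V ↦ ∇_V X`. -/
def divVec {m : ℕ} (G : MatrixField m) (X : Coord m → Fin m → ℝ) (y : Coord m) : ℝ :=
  ∑ i, covVec G X i i y

/-- The Laplacian on functions, with the sign convention `Δ f = - div (grad f)`. -/
def laplacian {m : ℕ} (G : MatrixField m) (f : Coord m → ℝ) (y : Coord m) : ℝ :=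
  - divVec G (grad G f) y

/-- The matrix of the `(1,1)`-tensor `∇ grad f : V ↦ ∇_V grad f`. -/
def nablaGrad {m : ℕ} (G : MatrixField m) (f : Coord m → ℝ) : MatrixField m :=
  fun y => Matrix.of fun k j => covVec G (grad G f) j k y

/-- The inner product of two `(1,1)`-tensors with matrices `A`, `B` at a point:
`⟨A, B⟩ = ∑ ⟨A X_i, B X_i⟩` over an orthonormal basis `X_i`, that is
`g^{ij} g_{kl} A^k_i B^l_j`. -/
def tensorInner {m : ℕ} (G : MatrixField m) (y : Coord m) (A B : Matrix (Fin m) (Fin m) ℝ) : ℝ :=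
  ∑ i, ∑ j, ∑ k, ∑ l, (G y)⁻¹ i j * G y k l * A k i * B l j

/-- The matrix of the `(1,1)`-tensor `∇_{∂_i} T`. -/
def covTensor {m : ℕ} (G : MatrixField m) (T : MatrixField m) (i : Fin m) : MatrixField m :=
  fun y => Matrix.of fun k j => pd i (fun z => T z k j) y
    + ∑ p, (christoffel G k i p y * T y p j - christoffel G p i j y * T y k p)

/-- The component `k` of the vector field `div T = trace ∇T = ∑ (∇_{X_i} T)(X_i)`, where `X_i` is
an orthonormal frame. -/
def divTensor {m : ℕ} (G : MatrixField m) (T : MatrixField m) (y : Coord m) (k : Fin m) : ℝ :=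
  ∑ i, ∑ j, (G y)⁻¹ i j * covTensor G T i y k j

/-- The squared length `|∇T|² = ∑ |∇_{X_i} T|²`, where `X_i` is an orthonormal frame. -/
def covTensorNormSq {m : ℕ} (G : MatrixField m) (T : MatrixField m) (y : Coord m) : ℝ :=
  ∑ i, ∑ j, (G y)⁻¹ i j * tensorInner G y (covTensor G T i y) (covTensor G T j y)

/-- The matrix of the `(1,1)`-tensor
`(∇²T)(∂_a, ∂_i, ·) = ∇_{∂_a} (∇_{∂_i} T) - ∇_{∇_{∂_a} ∂_i} T`. -/
def covTensor₂ {m : ℕ} (G : MatrixField m) (T : MatrixField m) (a i : Fin m) : MatrixField m :=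
  fun y => covTensor G (covTensor G T i) a y - ∑ p, christoffel G p a i y • covTensor G T p y

/-- The matrix of `trace ∇²T = ∑ (∇²T)(X_i, X_i, ·)`, where `X_i` is an orthonormal frame. -/
def traceCovTensor₂ {m : ℕ} (G : MatrixField m) (T : MatrixField m) : MatrixField m :=
  fun y => ∑ a, ∑ i, (G y)⁻¹ a i • covTensor₂ G T a i y

/-- The contraction of a `(1,1)`-tensor field `T` with a vector field `X`: the one-form
`⟨T, X⟩ : V ↦ ⟨T(V), X⟩`, by its components. -/
def contraction {m : ℕ} (G : MatrixField m) (T : MatrixField m) (X : Coord m → Fin m → ℝ)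
    (y : Coord m) (j : Fin m) : ℝ :=
  ∑ k, ∑ l, G y k l * T y k j * X y l

/-- The vector field `α^♯` dual to a one-form `α`. -/
def sharp {m : ℕ} (G : MatrixField m) (α : Coord m → Fin m → ℝ) (y : Coord m) (k : Fin m) : ℝ :=
  ∑ j, (G y)⁻¹ k j * α y j

/-! ### Maps in local coordinates

`G` is the metric of the source, `H` the metric of the target, and `f` the map in charts. -/

/-- The component `a` of `∇^f_{∂_i} W`, for a section `W` of the pull-back `f⁻¹(TN)` of the tangent
bundle of the target with the pull-back of its Levi-Civita connection. -/
def covAlong {m n : ℕ} (H : MatrixField n) (f : Coord m → Coord n) (W : Coord m → Fin n → ℝ)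
    (i : Fin m) (y : Coord m) (a : Fin n) : ℝ :=
  pd i (fun z => W z a) y
    + ∑ b, ∑ c, christoffel H a b c (f y) * pd i (fun z => f z b) y * W y c

/-- The component `a` of `(∇df)(∂_i, ∂_j) = ∇^f_{∂_i} (df(∂_j)) - df(∇_{∂_i} ∂_j)`. For a
Riemannian immersion this is the second fundamental form. -/
def secondFundamentalForm {m n : ℕ} (G : MatrixField m) (H : MatrixField n)
    (f : Coord m → Coord n) (i j : Fin m) (y : Coord m) (a : Fin n) : ℝ :=
  covAlong H f (fun z c => pd j (fun w => f w c) z) i y a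
    - ∑ k, christoffel G k i j y * pd k (fun z => f z a) y

/-- The tension field `τ(f) = trace ∇df`. -/
def tension {m n : ℕ} (G : MatrixField m) (H : MatrixField n) (f : Coord m → Coord n)
    (y : Coord m) (a : Fin n) : ℝ :=
  ∑ i, ∑ j, (G y)⁻¹ i j * secondFundamentalForm G H f i j y a

/-- The function `|τ(f)|²`. -/
def tensionNormSq {m n : ℕ} (G : MatrixField m) (H : MatrixField n) (f : Coord m → Coord n)
    (y : Coord m) : ℝ :=
  vecNormSq H (f y) (tension G H f y)

/-- The inner product `⟨df(∂_i), ∇^f_{∂_j} τ(f)⟩`. -/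
def innerDfNablaTension {m n : ℕ} (G : MatrixField m) (H : MatrixField n) (f : Coord m → Coord n)
    (i j : Fin m) (y : Coord m) : ℝ :=
  ∑ a, ∑ b, H (f y) a b * pd i (fun z => f z a) y * covAlong H f (tension G H f) j y b

/-- The value `⟨S₂(∂_i), ∂_j⟩` of the stress-bienergy tensor of `f`, where
`⟨S₂(X), Y⟩ = (1/2) |τ|² ⟨X, Y⟩ + ⟨df, ∇τ⟩ ⟨X, Y⟩ - ⟨df(X), ∇_Y τ⟩ - ⟨df(Y), ∇_X τ⟩`
and `⟨df, ∇τ⟩` is the trace of `(X, Y) ↦ ⟨df(X), ∇_Y τ⟩`. -/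
def stressBienergyForm {m n : ℕ} (G : MatrixField m) (H : MatrixField n) (f : Coord m → Coord n)
    (i j : Fin m) (y : Coord m) : ℝ :=
  (1 / 2) * tensionNormSq G H f y * G y i j
    + (∑ k, ∑ l, (G y)⁻¹ k l * innerDfNablaTension G H f k l y) * G y i j
    - innerDfNablaTension G H f i j y - innerDfNablaTension G H f j i y

/-- The stress-bienergy tensor `S₂` of `f`, as a tensor field of type `(1,1)`. -/
def stressBienergy {m n : ℕ} (G : MatrixField m) (H : MatrixField n) (f : Coord m → Coord n) :
    MatrixField m :=
  fun y => Matrix.of fun k j => ∑ i, (G y)⁻¹ k i * stressBienergyForm G H f j i y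

/-! ### Manifolds -/

section Manifolds

variable {m n : ℕ}
  {M : Type*} [TopologicalSpace M] [ChartedSpace (EuclideanSpace ℝ (Fin m)) M]
  [IsManifold (𝓡 m) ∞ M]
  {N : Type*} [TopologicalSpace N] [ChartedSpace (EuclideanSpace ℝ (Fin n)) N]
  [IsManifold (𝓡 n) ∞ N]

variable (m M) in
/-- A smooth Riemannian metric on the manifold `M` of dimension `m`. -/
abbrev RiemMetric :=
  ContMDiffRiemannianMetric (𝓡 m) ∞ (EuclideanSpace ℝ (Fin m)) (fun x : M => TangentSpace (𝓡 m) x)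

variable (m M) in
/-- A smooth tensor field of type `(1,1)` on `M`. -/
abbrev EndField :=
  ContMDiffSection (𝓡 m) (EuclideanSpace ℝ (Fin m) →L[ℝ] EuclideanSpace ℝ (Fin m)) ∞
    (fun x : M => TangentSpace (𝓡 m) x →L[ℝ] TangentSpace (𝓡 m) x)

/-- The coordinate vector field `∂_i` of the chart `e` at the point with coordinates `y`. -/
def coordVec (e : OpenPartialHomeomorph M (EuclideanSpace ℝ (Fin m))) (y : Coord m) (i : Fin m) :
    TangentSpace (𝓡 m) (e.symm y) :=
  mfderiv (𝓡 m) (𝓡 m) e.symm y (EuclideanSpace.single i (1 : ℝ) : EuclideanSpace ℝ (Fin m))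

/-- The matrix `g_{ij} = g(∂_i, ∂_j)` of a Riemannian metric in the chart `e`. -/
def metricInChart (g : RiemMetric m M)
    (e : OpenPartialHomeomorph M (EuclideanSpace ℝ (Fin m))) : MatrixField m :=
  fun y => Matrix.of fun i j => g.inner (e.symm y) (coordVec e y i) (coordVec e y j)

/-- The matrix `T^k_j` of a tensor field of type `(1,1)` in the chart `e`: `T^k_j` is the `k`-th
component of `de(T(∂_j))`. -/
def tensorInChart (T : EndField m M)
    (e : OpenPartialHomeomorph M (EuclideanSpace ℝ (Fin m))) : MatrixField m :=
  fun y => Matrix.of fun k j =>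
    let v : EuclideanSpace ℝ (Fin m) :=
      mfderiv (𝓡 m) (𝓡 m) e (e.symm y) (T (e.symm y) (coordVec e y j))
    v k

/-- The expression of a map in the charts `e` and `e'`. -/
def mapInCharts (φ : M → N) (e : OpenPartialHomeomorph M (EuclideanSpace ℝ (Fin m)))
    (e' : OpenPartialHomeomorph N (EuclideanSpace ℝ (Fin n))) : Coord m → Coord n :=
  fun y => e' (φ (e.symm y))

/-- A tensor field of type `(1,1)` is symmetric: `⟨T u, v⟩ = ⟨u, T v⟩`. -/
def IsSymmetricField (g : RiemMetric m M) (T : EndField m M) : Prop :=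
  ∀ (x : M) (u v : TangentSpace (𝓡 m) x), g.inner x (T x u) v = g.inner x u (T x v)

/-- `div T = 0`: all components of `div T` vanish in every chart. -/
def IsDivergenceFree (g : RiemMetric m M) (T : EndField m M) : Prop :=
  ∀ e ∈ IsManifold.maximalAtlas (𝓡 m) ∞ M, ∀ p ∈ e.source,
    divTensor (metricInChart g e) (tensorInChart T e) (e p) = 0

/-- A smooth Riemannian (isometric) immersion `(M, g) → (N, h)`. -/
def IsRiemannianImmersion (g : RiemMetric m M) (h : RiemMetric n N) (φ : M → N) : Prop :=
  ContMDiff (𝓡 m) (𝓡 n) ∞ φ ∧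
    ∀ (x : M) (u v : TangentSpace (𝓡 m) x),
      h.inner (φ x) (mfderiv (𝓡 m) (𝓡 n) φ x u) (mfderiv (𝓡 m) (𝓡 n) φ x v) = g.inner x u v

/-- A submanifold `φ : (M, g) → (N, h)` is biconservative: it is a Riemannian immersion and its
stress-bienergy tensor satisfies `div S₂ = 0`, that is, all components of `div S₂` vanish in all
charts. -/
def IsBiconservative (g : RiemMetric m M) (h : RiemMetric n N) (φ : M → N) : Prop :=
  IsRiemannianImmersion g h φ ∧
    ∀ e ∈ IsManifold.maximalAtlas (𝓡 m) ∞ M, ∀ e' ∈ IsManifold.maximalAtlas (𝓡 n) ∞ N,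
      ∀ p ∈ e.source, φ p ∈ e'.source →
        divTensor (metricInChart g e)
          (stressBienergy (metricInChart g e) (metricInChart h e') (mapInCharts φ e e')) (e p) = 0

end Manifolds

end Biconservative

end

open Filter Topology

noncomputable section

namespace Biconservative

/-! ### Calculus of matrix fields -/

section Calculus

variable {m p q r : ℕ}

/-! Both formulas are tensor identities, verified pointwise in an arbitrary chart. With `connMat` as
the matrix of the connection, ∇_i T is ∂_i T plus the commutator [Γ_i, T], so most of the tensor
calculus becomes noncommutative matrix algebra.

Part (1). For symmetric T, div T = 0 says ∑_i (∇_i T)^i_k = 0. In dimension two this and the trace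
determine the antisymmetric part of ∇T: it is built from dt alone, a Codazzi equation up to trace
(`covTensor₂_codazzi`, one derivative higher). In g^{ai} ∇²_{ai} T_j, Codazzi exchanges i and j at
the cost of Hessians of t. The Ricci identity `covTensor₂_comm` then exchanges a and j at the cost
of [R, T]. What remains is a derivative of div T, hence zero. On a surface R is K times a rotation
generator, and `curvMat_commutator` turns [R, T] into the terms 2KT - tK I.

Part (2). The Bochner formula ½Δ|T|² = -⟨trace ∇²T, T⟩ - |∇T|² is combined with part (1), with ⟨T, ∇
grad t⟩ = div ⟨T, grad t⟩^♯, which holds as div T = 0, and with ½Δ(t²) = tΔt - |grad t|². This gives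
`IsMetricOn.simons` for symmetric divergence-free T with trace t. It is applied to T = S₂, which is
symmetric by construction and, in dimension two, has trace |τ|². -/

theorem pd_congr {i : Fin m} {f g : Coord m → ℝ} {y : Coord m} (h : f =ᶠ[𝓝 y] g) :
    pd i f y = pd i g y := by
  simp only [pd, h.fderiv_eq]

theorem pd_add {i : Fin m} {f g : Coord m → ℝ} {y : Coord m} (hf : DifferentiableAt ℝ f y)
    (hg : DifferentiableAt ℝ g y) :
    pd i (fun z => f z + g z) y = pd i f y + pd i g y := by
  simp only [pd, fderiv_fun_add hf hg, add_apply]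

theorem pd_sub {i : Fin m} {f g : Coord m → ℝ} {y : Coord m} (hf : DifferentiableAt ℝ f y)
    (hg : DifferentiableAt ℝ g y) :
    pd i (fun z => f z - g z) y = pd i f y - pd i g y := by
  simp only [pd, fderiv_fun_sub hf hg, sub_apply]

theorem pd_mul {i : Fin m} {f g : Coord m → ℝ} {y : Coord m} (hf : DifferentiableAt ℝ f y)
    (hg : DifferentiableAt ℝ g y) :
    pd i (fun z => f z * g z) y = pd i f y * g y + f y * pd i g y := by
  simp only [pd, fderiv_fun_mul hf hg, add_apply, smul_apply, smul_eq_mul]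
  ring

theorem pd_sum {ι : Type*} {s : Finset ι} {i : Fin m} {f : ι → Coord m → ℝ} {y : Coord m}
    (hf : ∀ a ∈ s, DifferentiableAt ℝ (f a) y) :
    pd i (fun z => ∑ a ∈ s, f a z) y = ∑ a ∈ s, pd i (f a) y := by
  simp only [pd, fderiv_fun_sum hf, sum_apply]

theorem pd_const {i : Fin m} {c : ℝ} {y : Coord m} : pd i (fun _ => c) y = 0 := by
  simp [pd]

theorem _root_.ContDiffAt.pd {f : Coord m → ℝ} {y : Coord m} (hf : ContDiffAt ℝ ∞ f y)
    (i : Fin m) : ContDiffAt ℝ ∞ (fun z => Biconservative.pd i f z) y :=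
  (hf.fderiv_right (m := ∞) (by simp)).clm_apply contDiffAt_const

theorem _root_.ContDiffAt.differentiableAt_infty {f : Coord m → ℝ} {y : Coord m}
    (hf : ContDiffAt ℝ ∞ f y) : DifferentiableAt ℝ f y :=
  hf.differentiableAt (by simp)

theorem pd_comm {f : Coord m → ℝ} {y : Coord m} (hf : ContDiffAt ℝ ∞ f y) (i j : Fin m) :
    pd i (fun z => pd j f z) y = pd j (fun z => pd i f z) y := by
  have h : IsSymmSndFDerivAt ℝ f y := hf.isSymmSndFDerivAt
    (by simpa using WithTop.coe_le_coe.2 (le_top : (2 : ℕ∞) ≤ ⊤))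
  have hd : DifferentiableAt ℝ (fderiv ℝ f) y :=
    (hf.fderiv_right (m := ∞) (by simp)).differentiableAt (by simp)
  simp only [pd]
  rw [fderiv_clm_apply hd (by fun_prop), fderiv_clm_apply hd (by fun_prop)]
  simpa using h _ _

/-- All entries of the matrix-valued function `A` are smooth at `y`. -/
def SmoothMatAt (A : Coord m → Matrix (Fin p) (Fin q) ℝ) (y : Coord m) : Prop :=
  ∀ i j, ContDiffAt ℝ ∞ (fun z => A z i j) y

/-- The entrywise partial derivative of a matrix-valued function. -/
def pdMat (i : Fin m) (A : Coord m → Matrix (Fin p) (Fin q) ℝ) (y : Coord m) :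
    Matrix (Fin p) (Fin q) ℝ :=
  Matrix.of fun k j => pd i (fun z => A z k j) y

theorem pdMat_apply (i : Fin m) (A : Coord m → Matrix (Fin p) (Fin q) ℝ) (y : Coord m)
    (k : Fin p) (j : Fin q) : pdMat i A y k j = pd i (fun z => A z k j) y := rfl

theorem pdMat_congr {i : Fin m} {A B : Coord m → Matrix (Fin p) (Fin q) ℝ} {y : Coord m}
    (h : A =ᶠ[𝓝 y] B) : pdMat i A y = pdMat i B y := by
  ext k j
  exact pd_congr (h.fun_comp (fun A : Matrix (Fin p) (Fin q) ℝ => A k j))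

namespace SmoothMatAt

variable {A B : Coord m → Matrix (Fin p) (Fin q) ℝ} {C : Coord m → Matrix (Fin q) (Fin r) ℝ}
  {y : Coord m}

theorem congr (hA : SmoothMatAt A y) (h : B =ᶠ[𝓝 y] A) : SmoothMatAt B y := fun k j =>
  (hA k j).congr_of_eventuallyEq (h.fun_comp (fun A : Matrix (Fin p) (Fin q) ℝ => A k j))

theorem add (hA : SmoothMatAt A y) (hB : SmoothMatAt B y) :
    SmoothMatAt (fun z => A z + B z) y := fun k j => (hA k j).add (hB k j)

theorem sub (hA : SmoothMatAt A y) (hB : SmoothMatAt B y) :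
    SmoothMatAt (fun z => A z - B z) y := fun k j => (hA k j).sub (hB k j)

theorem mul (hA : SmoothMatAt A y) (hC : SmoothMatAt C y) :
    SmoothMatAt (fun z => A z * C z) y := fun k j => by
  simp only [Matrix.mul_apply]
  exact ContDiffAt.sum fun a _ => (hA k a).mul (hC a j)

theorem transpose (hA : SmoothMatAt A y) : SmoothMatAt (fun z => (A z)ᵀ) y :=
  fun k j => hA j k

theorem pdMat (hA : SmoothMatAt A y) (i : Fin m) :
    SmoothMatAt (fun z => Biconservative.pdMat i A z) y := fun k j => (hA k j).pd i

theorem trace {A : Coord m → Matrix (Fin p) (Fin p) ℝ} (hA : SmoothMatAt A y) :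
    ContDiffAt ℝ ∞ (fun z => (A z).trace) y := by
  simp only [Matrix.trace, Matrix.diag]
  exact ContDiffAt.sum fun a _ => hA a a

theorem det {A : Coord m → Matrix (Fin p) (Fin p) ℝ} (hA : SmoothMatAt A y) :
    ContDiffAt ℝ ∞ (fun z => (A z).det) y := by
  simp only [Matrix.det_apply]
  exact ContDiffAt.sum fun s _ => (contDiffAt_prod fun a _ => hA _ _).const_smul _

/-- Cramer's rule: the entries are quotients by det A of determinants of A with one row replaced by
a constant vector. -/
theorem inv {A : Coord m → Matrix (Fin p) (Fin p) ℝ} (hA : SmoothMatAt A y)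
    (h : IsUnit (A y).det) : SmoothMatAt (fun z => (A z)⁻¹) y := by
  intro k j
  simp only [Matrix.inv_def, Ring.inverse_eq_inv', Matrix.smul_apply, Matrix.adjugate_apply,
    smul_eq_mul]
  refine (hA.det.inv h.ne_zero).mul (SmoothMatAt.det fun a b => ?_)
  by_cases hb : a = j
  · simp only [hb, Matrix.updateRow_self]
    exact contDiffAt_const
  · simp only [Matrix.updateRow_ne hb]
    exact hA a b

end SmoothMatAt

variable {A B : Coord m → Matrix (Fin p) (Fin q) ℝ} {C : Coord m → Matrix (Fin q) (Fin r) ℝ}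
  {y : Coord m}

theorem pdMat_add (i : Fin m) (hA : SmoothMatAt A y) (hB : SmoothMatAt B y) :
    pdMat i (fun z => A z + B z) y = pdMat i A y + pdMat i B y := by
  ext k j
  exact pd_add (hA k j).differentiableAt_infty (hB k j).differentiableAt_infty

theorem pdMat_sub (i : Fin m) (hA : SmoothMatAt A y) (hB : SmoothMatAt B y) :
    pdMat i (fun z => A z - B z) y = pdMat i A y - pdMat i B y := by
  ext k j
  exact pd_sub (hA k j).differentiableAt_infty (hB k j).differentiableAt_infty

theorem pdMat_mul (i : Fin m) (hA : SmoothMatAt A y) (hC : SmoothMatAt C y) :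
    pdMat i (fun z => A z * C z) y = pdMat i A y * C y + A y * pdMat i C y := by
  ext k j
  have h1 : ∀ a, DifferentiableAt ℝ (fun z => A z k a) y :=
    fun a => (hA k a).differentiableAt_infty
  have h2 : ∀ a, DifferentiableAt ℝ (fun z => C z a j) y :=
    fun a => (hC a j).differentiableAt_infty
  simp only [pdMat_apply, Matrix.mul_apply, Matrix.add_apply]
  rw [pd_sum fun a _ => (h1 a).fun_mul (h2 a), ← Finset.sum_add_distrib]
  exact Finset.sum_congr rfl fun a _ => pd_mul (h1 a) (h2 a)

theorem pdMat_transpose (i : Fin m) : pdMat i (fun z => (A z)ᵀ) y = (pdMat i A y)ᵀ := rfl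

theorem pd_trace {A : Coord m → Matrix (Fin p) (Fin p) ℝ} (i : Fin m) (hA : SmoothMatAt A y) :
    pd i (fun z => (A z).trace) y = (pdMat i A y).trace := by
  simp only [Matrix.trace, Matrix.diag]
  exact pd_sum fun a _ => (hA a a).differentiableAt_infty

theorem pdMat_comm (hA : SmoothMatAt A y) (i j : Fin m) :
    pdMat i (fun z => pdMat j A z) y = pdMat j (fun z => pdMat i A z) y := by
  ext k l
  exact pd_comm (hA k l) i j

end Calculus

/-! ### The Levi-Civita connection of a metric on an open subset of `ℝᵐ` -/

/-- `G` is the matrix of a smooth, symmetric, nondegenerate bilinear form on the open set `U`. -/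
structure IsMetricOn {m : ℕ} (G : MatrixField m) (U : Set (Coord m)) : Prop where
  isOpen : IsOpen U
  smooth : ∀ y ∈ U, SmoothMatAt G y
  symm : ∀ y ∈ U, (G y)ᵀ = G y
  det : ∀ y ∈ U, IsUnit (G y).det

/-- The matrix `(Γ_i)^k_j = Γ^k_{ij}` of the Levi-Civita connection. -/
def connMat {m : ℕ} (G : MatrixField m) (i : Fin m) : MatrixField m :=
  fun y => Matrix.of fun k j => christoffel G k i j y

theorem connMat_apply {m : ℕ} (G : MatrixField m) (i k j : Fin m) (y : Coord m) :
    connMat G i y k j = christoffel G k i j y := rfl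

/-- The commutator form allows index-free proofs; in particular the connection term has zero trace.
-/
theorem covTensor_eq {m : ℕ} (G T : MatrixField m) (i : Fin m) (y : Coord m) :
    covTensor G T i y = pdMat i T y + (connMat G i y * T y - T y * connMat G i y) := by
  ext k j
  simp only [covTensor, Matrix.of_apply, Matrix.add_apply, Matrix.sub_apply, Matrix.mul_apply,
    pdMat_apply, connMat_apply, Finset.sum_sub_distrib]
  simp only [mul_comm]

namespace IsMetricOn

variable {m : ℕ} {G : MatrixField m} {U : Set (Coord m)} {y : Coord m}

theorem eventually_of_forall (hG : IsMetricOn G U) {P : Coord m → Prop} (h : ∀ z ∈ U, P z)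
    (hy : y ∈ U) : ∀ᶠ z in 𝓝 y, P z :=
  (hG.isOpen.eventually_mem hy).mono h

theorem mono (hG : IsMetricOn G U) {V : Set (Coord m)} (hV : IsOpen V) (h : V ⊆ U) :
    IsMetricOn G V :=
  ⟨hV, fun y hy => hG.smooth y (h hy), fun y hy => hG.symm y (h hy), fun y hy => hG.det y (h hy)⟩

theorem inv_symm (hG : IsMetricOn G U) (hy : y ∈ U) : ((G y)⁻¹)ᵀ = (G y)⁻¹ := by
  rw [Matrix.transpose_nonsing_inv, hG.symm y hy]

theorem symm_apply (hG : IsMetricOn G U) (hy : y ∈ U) (i j : Fin m) : G y i j = G y j i :=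
  congrFun (congrFun (hG.symm y hy) j) i

theorem inv_symm_apply (hG : IsMetricOn G U) (hy : y ∈ U) (i j : Fin m) :
    (G y)⁻¹ i j = (G y)⁻¹ j i :=
  congrFun (congrFun (hG.inv_symm hy) j) i

theorem pd_symm (hG : IsMetricOn G U) (hy : y ∈ U) (a i j : Fin m) :
    pd a (fun z => G z i j) y = pd a (fun z => G z j i) y :=
  pd_congr (hG.eventually_of_forall (fun _ hz => hG.symm_apply hz i j) hy)

theorem smooth_inv (hG : IsMetricOn G U) (hy : y ∈ U) : SmoothMatAt (fun z => (G z)⁻¹) y :=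
  (hG.smooth y hy).inv (hG.det y hy)

theorem smooth_christoffel (hG : IsMetricOn G U) (hy : y ∈ U) (k i j : Fin m) :
    ContDiffAt ℝ ∞ (fun z => christoffel G k i j z) y := by
  have h := hG.smooth y hy
  unfold christoffel
  exact contDiffAt_const.mul (ContDiffAt.sum fun l _ => (hG.smooth_inv hy k l).mul
    ((((h j l).pd i).add ((h i l).pd j)).sub ((h i j).pd l)))

theorem smooth_connMat (hG : IsMetricOn G U) (hy : y ∈ U) (i : Fin m) :
    SmoothMatAt (connMat G i) y := fun k j => hG.smooth_christoffel hy k i j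

theorem christoffel_symm (hG : IsMetricOn G U) (hy : y ∈ U) (k i j : Fin m) :
    christoffel G k i j y = christoffel G k j i y := by
  simp only [christoffel, hG.pd_symm hy _ i j]
  congr 1
  exact Finset.sum_congr rfl fun l _ => by ring

/-- Lowering the upper index removes the inverse metric and leaves the Christoffel symbols of the
first kind. -/
theorem mul_connMat_apply (hG : IsMetricOn G U) (hy : y ∈ U) (i a j : Fin m) :
    (G y * connMat G i y) a j = (1 / 2) *
      (pd i (fun z => G z j a) y + pd j (fun z => G z i a) y - pd a (fun z => G z i j) y) := by
  have : connMat G i y = (G y)⁻¹ * Matrix.of fun l j => (1 / 2) *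
      (pd i (fun z => G z j l) y + pd j (fun z => G z i l) y - pd l (fun z => G z i j) y) := by
    ext k j
    simp only [connMat_apply, christoffel, Matrix.mul_apply, Matrix.of_apply, Finset.mul_sum]
    exact Finset.sum_congr rfl fun l _ => by ring
  rw [this, Matrix.mul_nonsing_inv_cancel_left _ _ (hG.det y hy)]
  rfl

/-- Metric compatibility of the Levi-Civita connection. -/
theorem pdMat_metric (hG : IsMetricOn G U) (hy : y ∈ U) (i : Fin m) :
    pdMat i G y = (connMat G i y)ᵀ * G y + G y * connMat G i y := by
  have : (connMat G i y)ᵀ * G y = (G y * connMat G i y)ᵀ := by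
    rw [Matrix.transpose_mul, hG.symm y hy]
  rw [this]
  ext a j
  simp only [Matrix.add_apply, Matrix.transpose_apply, hG.mul_connMat_apply hy, pdMat_apply,
    hG.pd_symm hy _ j a]
  ring

/-- Differentiate G⁻¹ G = 1 and insert metric compatibility: the inverse metric is parallel too. -/
theorem pdMat_inv (hG : IsMetricOn G U) (hy : y ∈ U) (i : Fin m) :
    pdMat i (fun z => (G z)⁻¹) y =
      - (connMat G i y * (G y)⁻¹ + (G y)⁻¹ * (connMat G i y)ᵀ) := by
  have h1 : pdMat i (fun z => (G z)⁻¹ * G z) y = 0 := by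
    rw [pdMat_congr (B := fun _ => 1)
      (hG.eventually_of_forall (fun z hz => Matrix.nonsing_inv_mul _ (hG.det z hz)) hy)]
    ext k j
    exact pd_const
  rw [pdMat_mul i (hG.smooth_inv hy) (hG.smooth y hy), hG.pdMat_metric hy] at h1
  have h2 := Matrix.mul_nonsing_inv _ (hG.det y hy)
  have h3 := Matrix.nonsing_inv_mul _ (hG.det y hy)
  calc pdMat i (fun z => (G z)⁻¹) y = (pdMat i (fun z => (G z)⁻¹) y * G y) * (G y)⁻¹ := by
        rw [mul_assoc, h2, mul_one]
    _ = - ((G y)⁻¹ * ((connMat G i y)ᵀ * G y + G y * connMat G i y)) * (G y)⁻¹ := by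
        rw [eq_neg_of_add_eq_zero_left h1]
    _ = - ((G y)⁻¹ * (connMat G i y)ᵀ * (G y * (G y)⁻¹)
          + (G y)⁻¹ * G y * connMat G i y * (G y)⁻¹) := by noncomm_ring
    _ = _ := by rw [h2, h3, mul_one, one_mul, add_comm]

theorem pd_inv (hG : IsMetricOn G U) (hy : y ∈ U) (i k j : Fin m) :
    pd i (fun z => (G z)⁻¹ k j) y =
      - (∑ p, (christoffel G k i p y * (G y)⁻¹ p j + christoffel G j i p y * (G y)⁻¹ k p)) := by
  have := congrFun (congrFun (hG.pdMat_inv hy i) k) j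
  rw [pdMat_apply] at this
  rw [this]
  simp only [Matrix.neg_apply, Matrix.add_apply, Matrix.mul_apply, connMat_apply,
    Matrix.transpose_apply, Finset.sum_add_distrib]
  simp only [mul_comm]

theorem smooth_covTensor (hG : IsMetricOn G U) (hy : y ∈ U) {T : MatrixField m}
    (hT : SmoothMatAt T y) (i : Fin m) : SmoothMatAt (covTensor G T i) y := by
  have := (hT.pdMat i).add (((hG.smooth_connMat hy i).mul hT).sub
    (hT.mul (hG.smooth_connMat hy i)))
  exact this.congr (Eventually.of_forall fun z => covTensor_eq G T i z)

theorem smooth_grad (hG : IsMetricOn G U) (hy : y ∈ U) {f : Coord m → ℝ}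
    (hf : ContDiffAt ℝ ∞ f y) (k : Fin m) : ContDiffAt ℝ ∞ (fun z => grad G f z k) y :=
  ContDiffAt.sum fun j _ => (hG.smooth_inv hy k j).mul (hf.pd j)

end IsMetricOn

/-- The components of the Hessian `∇ df` of a function. -/
def hess {m : ℕ} (G : MatrixField m) (f : Coord m → ℝ) (i j : Fin m) (y : Coord m) : ℝ :=
  pd i (fun z => pd j f z) y - ∑ p, christoffel G p i j y * pd p f y

namespace IsMetricOn

variable {m : ℕ} {G : MatrixField m} {U : Set (Coord m)} {y : Coord m}

theorem hess_symm (hG : IsMetricOn G U) (hy : y ∈ U) {f : Coord m → ℝ}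
    (hf : ContDiffAt ℝ ∞ f y) (i j : Fin m) : hess G f i j y = hess G f j i y := by
  simp only [hess, pd_comm hf i j, hG.christoffel_symm hy _ i j]

/-- Raising an index commutes with ∇: the Γ^k part of the derivative of G⁻¹ cancels the connection
term of `covVec`, and the other part is the correction in `hess`. -/
theorem nablaGrad_apply (hG : IsMetricOn G U) (hy : y ∈ U) {f : Coord m → ℝ}
    (hf : ContDiffAt ℝ ∞ f y) (k j : Fin m) :
    nablaGrad G f y k j = ∑ a, (G y)⁻¹ k a * hess G f j a y := by
  have h1 : pd j (fun z => grad G f z k) y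
      = ∑ a, (pd j (fun z => (G z)⁻¹ k a) y * pd a f y
        + (G y)⁻¹ k a * pd j (fun z => pd a f z) y) := by
    unfold grad
    rw [pd_sum fun a _ => ((hG.smooth_inv hy k a).mul (hf.pd a)).differentiableAt_infty]
    exact Finset.sum_congr rfl fun a _ =>
      pd_mul (hG.smooth_inv hy k a).differentiableAt_infty (hf.pd a).differentiableAt_infty
  simp only [nablaGrad, Matrix.of_apply, covVec]
  rw [h1]
  simp only [hG.pd_inv hy, grad, hess, mul_sub, Finset.sum_sub_distrib, Finset.sum_add_distrib,
    add_mul, neg_mul, Finset.mul_sum, Finset.sum_mul, Finset.sum_neg_distrib, neg_add]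
  rw [Finset.sum_comm (f := fun a p => christoffel G k j p y * (G y)⁻¹ p a * pd a f y),
    Finset.sum_comm (f := fun a p => christoffel G a j p y * (G y)⁻¹ k p * pd a f y)]
  have h2 : ∀ a p, (G y)⁻¹ k a * (christoffel G p j a y * pd p f y)
    = christoffel G p j a y * (G y)⁻¹ k a * pd p f y := fun a p => by ring
  simp only [h2, mul_assoc]
  ring

theorem laplacian_eq (hG : IsMetricOn G U) (hy : y ∈ U) {f : Coord m → ℝ}
    (hf : ContDiffAt ℝ ∞ f y) :
    laplacian G f y = - ∑ i, ∑ j, (G y)⁻¹ i j * hess G f i j y := by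
  have : divVec G (grad G f) y = ∑ i, nablaGrad G f y i i := rfl
  simp only [laplacian, this, hG.nablaGrad_apply hy hf]

end IsMetricOn

/-! ### Second covariant derivatives and curvature -/

/-- The matrix `R(∂_i, ∂_j)^l_k` of the curvature endomorphism. -/
def curvMat {m : ℕ} (G : MatrixField m) (i j : Fin m) : MatrixField m :=
  fun y => pdMat i (connMat G j) y - pdMat j (connMat G i) y
    + (connMat G i y * connMat G j y - connMat G j y * connMat G i y)

theorem curvMat_apply {m : ℕ} (G : MatrixField m) (i j l k : Fin m) (y : Coord m) :
    curvMat G i j y l k = riemann G l k i j y := by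
  simp only [curvMat, riemann, Matrix.add_apply, Matrix.sub_apply, Matrix.mul_apply, pdMat_apply,
    connMat_apply, Finset.sum_sub_distrib]

theorem covTensor₂_apply {m : ℕ} (G T : MatrixField m) (a i k j : Fin m) (y : Coord m) :
    covTensor₂ G T a i y k j = pd a (fun z => covTensor G T i z k j) y
      + ∑ p, (christoffel G k a p y * covTensor G T i y p j
          - christoffel G p a j y * covTensor G T i y k p)
      - ∑ p, christoffel G p a i y * covTensor G T p y k j := by
  simp only [covTensor₂, Matrix.sub_apply, Matrix.sum_apply, Matrix.smul_apply, smul_eq_mul]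
  rfl

namespace IsMetricOn

variable {m : ℕ} {G : MatrixField m} {U : Set (Coord m)} {y : Coord m} {T : MatrixField m}

theorem pdMat_covTensor (hG : IsMetricOn G U) (hy : y ∈ U) (hT : SmoothMatAt T y) (a i : Fin m) :
    pdMat a (covTensor G T i) y = pdMat a (fun z => pdMat i T z) y
      + (pdMat a (connMat G i) y * T y + connMat G i y * pdMat a T y
        - (pdMat a T y * connMat G i y + T y * pdMat a (connMat G i) y)) := by
  have hΓ := hG.smooth_connMat hy i
  rw [pdMat_congr (Eventually.of_forall fun z => covTensor_eq G T i z),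
    pdMat_add a (hT.pdMat i) ((hΓ.mul hT).sub (hT.mul hΓ)),
    pdMat_sub a (hΓ.mul hT) (hT.mul hΓ), pdMat_mul a hΓ hT, pdMat_mul a hT hΓ]

/-- The Ricci identity for tensors of type `(1,1)`. -/
theorem covTensor₂_comm (hG : IsMetricOn G U) (hy : y ∈ U) (hT : SmoothMatAt T y) (a i : Fin m) :
    covTensor₂ G T a i y - covTensor₂ G T i a y
      = curvMat G a i y * T y - T y * curvMat G a i y := by
  -- The connection is torsion-free, so the corrections ∇_{∇_a ∂_i} T agree in both orders and
  -- cancel.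
  simp only [covTensor₂, hG.christoffel_symm hy _ a i]
  rw [sub_sub_sub_cancel_right, covTensor_eq G (covTensor G T i), hG.pdMat_covTensor hy hT,
    covTensor_eq G (covTensor G T a), hG.pdMat_covTensor hy hT, covTensor_eq, covTensor_eq,
    pdMat_comm hT a i, curvMat]
  noncomm_ring

/-- The curvature endomorphisms are skew-symmetric. -/
theorem curvMat_skew (hG : IsMetricOn G U) (hy : y ∈ U) (a i : Fin m) :
    (curvMat G a i y)ᵀ * G y + G y * curvMat G a i y = 0 := by
  -- Metric compatibility differentiated once more; equality of mixed partials of G then forces the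
  -- skew-symmetry.
  have h : ∀ a i, pdMat a (fun z => pdMat i G z) y =
      (pdMat a (connMat G i) y)ᵀ * G y
        + (connMat G i y)ᵀ * ((connMat G a y)ᵀ * G y + G y * connMat G a y)
        + (((connMat G a y)ᵀ * G y + G y * connMat G a y) * connMat G i y
          + G y * pdMat a (connMat G i) y) := fun a i => by
    have hΓ := hG.smooth_connMat hy i
    have hs := hG.smooth y hy
    rw [pdMat_congr (hG.eventually_of_forall (fun z hz => hG.pdMat_metric hz i) hy),
      pdMat_add a (hΓ.transpose.mul hs) (hs.mul hΓ), pdMat_mul a hΓ.transpose hs,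
      pdMat_mul a hs hΓ, hG.pdMat_metric hy, pdMat_transpose]
  have h1 := pdMat_comm (hG.smooth y hy) a i
  rw [h, h] at h1
  rw [← sub_eq_zero] at h1
  rw [← h1]
  simp only [curvMat, Matrix.transpose_add, Matrix.transpose_sub, Matrix.transpose_mul]
  noncomm_ring

/-- The covariant derivative of a symmetric tensor is symmetric. -/
theorem covTensor_symm (hG : IsMetricOn G U) (hT : ∀ z ∈ U, SmoothMatAt T z)
    (hs : ∀ z ∈ U, G z * T z = (T z)ᵀ * G z) (hy : y ∈ U) (i : Fin m) :
    G y * covTensor G T i y = (covTensor G T i y)ᵀ * G y := by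
  -- Differentiate the symmetry relation itself; the derivatives of G are replaced through metric
  -- compatibility.
  have h := pdMat_congr (i := i) (hG.eventually_of_forall hs hy)
  have hsm := hG.smooth y hy
  rw [pdMat_mul i hsm (hT y hy), pdMat_mul i (hT y hy).transpose hsm, hG.pdMat_metric hy,
    pdMat_transpose] at h
  rw [covTensor_eq]
  simp only [Matrix.transpose_add, Matrix.transpose_sub, Matrix.transpose_mul]
  have e : G y * pdMat i T y = (pdMat i T y)ᵀ * G y
      + (T y)ᵀ * ((connMat G i y)ᵀ * G y + G y * connMat G i y)
      - ((connMat G i y)ᵀ * G y + G y * connMat G i y) * T y := by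
    rw [← h]; abel
  have e2 := hs y hy
  have e3 : G y * (T y * connMat G i y) = (T y)ᵀ * (G y * connMat G i y) := by
    rw [← mul_assoc, e2, mul_assoc]
  calc _ = G y * pdMat i T y + G y * connMat G i y * T y - (G y * T y) * connMat G i y := by
        noncomm_ring
    _ = (pdMat i T y)ᵀ * G y + (T y)ᵀ * (connMat G i y)ᵀ * G y
        - (connMat G i y)ᵀ * (G y * T y) := by
        simp only [e, add_mul, mul_assoc, mul_add, e3]; abel
    _ = _ := by rw [e2]; noncomm_ring

theorem trace_covTensor (i : Fin m) (hT : SmoothMatAt T y) :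
    (covTensor G T i y).trace = pd i (fun z => (T z).trace) y := by
  rw [covTensor_eq, Matrix.trace_add, Matrix.trace_sub, Matrix.trace_mul_comm, sub_self, add_zero,
    pd_trace i hT]

/-- A self-adjoint endomorphism becomes a symmetric matrix once its lower index is raised. -/
theorem mul_inv_comm (hG : IsMetricOn G U) (hy : y ∈ U) {A : Matrix (Fin m) (Fin m) ℝ}
    (h : G y * A = Aᵀ * G y) : A * (G y)⁻¹ = (G y)⁻¹ * Aᵀ := by
  calc A * (G y)⁻¹ = (G y)⁻¹ * (G y * A) * (G y)⁻¹ := by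
        rw [Matrix.nonsing_inv_mul_cancel_left _ _ (hG.det y hy)]
    _ = (G y)⁻¹ * Aᵀ := by
        rw [h, mul_assoc, Matrix.mul_nonsing_inv_cancel_right _ _ (hG.det y hy)]

/-- Contracting a family of symmetric matrices with the inverse metric amounts to taking the
trace in the upper index. -/
theorem sum_inv_mul_apply (hG : IsMetricOn G U) (hy : y ∈ U)
    {A : Fin m → Matrix (Fin m) (Fin m) ℝ} (h : ∀ i, G y * A i = (A i)ᵀ * G y) (k : Fin m) :
    ∑ i, ∑ j, (G y)⁻¹ i j * A i k j = ∑ j, (G y)⁻¹ k j * ∑ i, A i i j := by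
  have h1 : ∀ i, ∑ j, (G y)⁻¹ i j * A i k j = ∑ j, (G y)⁻¹ k j * A i i j := fun i => by
    have := congrFun (congrFun (hG.mul_inv_comm hy (h i)) k) i
    simp only [Matrix.mul_apply, Matrix.transpose_apply] at this
    rw [← this]
    exact Finset.sum_congr rfl fun j _ => by rw [hG.inv_symm_apply hy, mul_comm]
  simp only [h1, Finset.mul_sum]
  exact Finset.sum_comm

/-- The divergence of a symmetric tensor is the trace of its covariant derivative. -/
theorem sum_covTensor_eq_zero (hG : IsMetricOn G U) (hT : ∀ z ∈ U, SmoothMatAt T z)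
    (hs : ∀ z ∈ U, G z * T z = (T z)ᵀ * G z) (hdiv : ∀ z ∈ U, divTensor G T z = 0) (hy : y ∈ U)
    (k : Fin m) : ∑ i, covTensor G T i y i k = 0 := by
  have h : (G y)⁻¹ *ᵥ (fun j => ∑ i, covTensor G T i y i j) = 0 := by
    ext k
    have := hG.sum_inv_mul_apply hy (fun i => hG.covTensor_symm hT hs hy i) k
    rw [Matrix.mulVec, dotProduct, ← this]
    exact congrFun (hdiv y hy) k
  have h2 := congrArg (fun v => G y *ᵥ v) h
  simp only [Matrix.mulVec_mulVec, Matrix.mul_nonsing_inv _ (hG.det y hy), Matrix.one_mulVec,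
    Matrix.mulVec_zero] at h2
  exact congrFun h2 k

/-- Contraction commutes with ∇: this is the covariant derivative of the vanishing one-form div T.
The Christoffel terms of the two contracted slots cancel each other. -/
theorem sum_covTensor₂_eq_zero (hG : IsMetricOn G U) (hT : ∀ z ∈ U, SmoothMatAt T z)
    (hs : ∀ z ∈ U, G z * T z = (T z)ᵀ * G z) (hdiv : ∀ z ∈ U, divTensor G T z = 0) (hy : y ∈ U)
    (a k : Fin m) : ∑ i, covTensor₂ G T a i y i k = 0 := by
  have h0 : ∑ i, pd a (fun z => covTensor G T i z i k) y = 0 := by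
    rw [← pd_sum fun i _ => (hG.smooth_covTensor hy (hT y hy) i i k).differentiableAt_infty,
      pd_congr (g := fun _ => 0) (hG.eventually_of_forall
        (fun z hz => hG.sum_covTensor_eq_zero hT hs hdiv hz k) hy), pd_const]
  have h1 : ∑ i, ∑ p, christoffel G p a k y * covTensor G T i y i p = 0 := by
    rw [Finset.sum_comm]
    simp only [← Finset.mul_sum, hG.sum_covTensor_eq_zero hT hs hdiv hy, mul_zero,
      Finset.sum_const_zero]
  simp only [covTensor₂_apply, Finset.sum_sub_distrib, Finset.sum_add_distrib, h0, h1]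
  rw [Finset.sum_comm]
  ring

/-- Each ∇_i T is itself a symmetric field, so `covTensor_symm` applies a second time. -/
theorem covTensor₂_symm (hG : IsMetricOn G U) (hT : ∀ z ∈ U, SmoothMatAt T z)
    (hs : ∀ z ∈ U, G z * T z = (T z)ᵀ * G z) (hy : y ∈ U) (a i : Fin m) :
    G y * covTensor₂ G T a i y = (covTensor₂ G T a i y)ᵀ * G y := by
  have h1 := hG.covTensor_symm (fun z hz => hG.smooth_covTensor hz (hT z hz) i)
    (fun z hz => hG.covTensor_symm hT hs hz i) hy a
  simp only [covTensor₂, mul_sub, Matrix.transpose_sub, sub_mul, h1, Finset.mul_sum,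
    Matrix.transpose_sum, Finset.sum_mul, Matrix.transpose_smul, Matrix.mul_smul, Matrix.smul_mul,
    hG.covTensor_symm hT hs hy]

theorem trace_covTensor₂ (hG : IsMetricOn G U) (hT : ∀ z ∈ U, SmoothMatAt T z) (hy : y ∈ U)
    (a i : Fin m) :
    (covTensor₂ G T a i y).trace = hess G (fun z => (T z).trace) a i y := by
  simp only [covTensor₂, Matrix.trace_sub, Matrix.trace_sum, Matrix.trace_smul, smul_eq_mul,
    trace_covTensor _ (hT y hy), hess]
  rw [trace_covTensor a (hG.smooth_covTensor hy (hT y hy) i), pd_congr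
    (hG.eventually_of_forall (fun z hz => trace_covTensor (G := G) i (hT z hz)) hy)]

end IsMetricOn

/-! ### Surfaces -/

namespace IsMetricOn

variable {G : MatrixField 2} {U : Set (Coord 2)} {y : Coord 2} {T : MatrixField 2}

/-- The curvature endomorphism of a surface is determined by the Gaussian curvature. -/
theorem curvMat_eq (hG : IsMetricOn G U) (hy : y ∈ U) :
    curvMat G 0 1 y = (gaussCurvature G y * (G y).det) • ((G y)⁻¹ * !![0, 1; -1, 0]) := by
  -- With its index lowered the curvature is a skew 2×2 matrix, so a single entry remains, and that
  -- entry defines K.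
  have h : G y * curvMat G 0 1 y = (gaussCurvature G y * (G y).det) • !![0, 1; -1, 0] := by
    have h1 := hG.curvMat_skew hy 0 1
    have h2 : (curvMat G 0 1 y)ᵀ * G y = (G y * curvMat G 0 1 y)ᵀ := by
      rw [Matrix.transpose_mul, hG.symm y hy]
    rw [h2] at h1
    have h3 : (G y * curvMat G 0 1 y) 0 1 = gaussCurvature G y * (G y).det := by
      rw [gaussCurvature, div_mul_cancel₀ _ (hG.det y hy).ne_zero]
      simp only [Matrix.mul_apply, curvMat_apply]
      exact Finset.sum_congr rfl fun l _ => by rw [hG.symm_apply hy]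
    have h4 := fun k j => congrFun (congrFun h1 k) j
    simp only [Matrix.add_apply, Matrix.transpose_apply, Matrix.zero_apply] at h4
    ext k j
    fin_cases k <;> fin_cases j <;> simp
    · linarith [h4 0 0]
    · exact h3
    · linarith [h4 0 1]
    · linarith [h4 1 1]
  rw [← Matrix.mul_smul, ← h, Matrix.nonsing_inv_mul_cancel_left _ _ (hG.det y hy)]

/-- Raising the lower index cancels every factor of G on the right, leaving only K, A and the
constant rotation matrix. -/
theorem curvMat_commutator (hG : IsMetricOn G U) (hy : y ∈ U) {A : Matrix (Fin 2) (Fin 2) ℝ}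
    (h : G y * A = Aᵀ * G y) :
    (curvMat G 0 1 y * A - A * curvMat G 0 1 y) * (G y)⁻¹ =
      gaussCurvature G y • (!![0, 1; -1, 0] * Aᵀ - A * !![0, 1; -1, 0]) := by
  -- The 2×2 identity B J Bᵀ = (det B) J, for the symmetric matrix B = G⁻¹.
  have h1 : (G y).det • ((G y)⁻¹ * !![0, 1; -1, 0] * (G y)⁻¹) = !![0, 1; -1, 0] := by
    have hd : (G y).det * (G y)⁻¹.det = 1 := by
      rw [← Matrix.det_mul, Matrix.mul_nonsing_inv _ (hG.det y hy), Matrix.det_one]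
    rw [Matrix.det_fin_two (G y)⁻¹] at hd
    have hs := hG.inv_symm_apply hy 0 1
    ext k j
    fin_cases k <;> fin_cases j <;>
      simp [Matrix.mul_apply, Fin.sum_univ_two, -mul_eq_zero, -neg_add_rev]
    · linear_combination -(G y).det * (G y)⁻¹ 0 0 * hs
    · linear_combination hd - (G y).det * (G y)⁻¹ 0 1 * hs
    · linear_combination -hd - (G y).det * (G y)⁻¹ 1 0 * hs
    · linear_combination -(G y).det * (G y)⁻¹ 1 1 * hs
  have h2 := hG.mul_inv_comm hy h
  rw [hG.curvMat_eq hy, mul_smul, sub_mul, Matrix.smul_mul, Matrix.smul_mul, Matrix.mul_smul,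
    Matrix.smul_mul, Matrix.smul_mul, Matrix.smul_mul, Matrix.mul_smul, Matrix.smul_mul, mul_assoc,
    h2, ← smul_sub]
  conv_rhs => rw [← h1]
  simp only [Matrix.mul_smul, Matrix.smul_mul, ← smul_sub, mul_assoc]

/-- The second covariant derivative of a symmetric divergence-free tensor on a surface is
symmetric in its last two arguments up to a term involving the Hessian of the trace. -/
theorem covTensor₂_codazzi (hG : IsMetricOn G U) (hT : ∀ z ∈ U, SmoothMatAt T z)
    (hs : ∀ z ∈ U, G z * T z = (T z)ᵀ * G z) (hdiv : ∀ z ∈ U, divTensor G T z = 0) (hy : y ∈ U)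
    (a k : Fin 2) :
    covTensor₂ G T a 0 y k 1 - covTensor₂ G T a 1 y k 0 =
      hess G (fun z => (T z).trace) a 0 y * (1 : Matrix (Fin 2) (Fin 2) ℝ) k 1
        - hess G (fun z => (T z).trace) a 1 y * (1 : Matrix (Fin 2) (Fin 2) ℝ) k 0 := by
  -- The divergence relation trades each off-diagonal component for a diagonal one; the two diagonal
  -- components then add up to the trace, whose second derivative is a Hessian.
  have h0 := hG.sum_covTensor₂_eq_zero hT hs hdiv hy a 0
  have h1 := hG.sum_covTensor₂_eq_zero hT hs hdiv hy a 1
  have t0 := hG.trace_covTensor₂ hT hy a 0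
  have t1 := hG.trace_covTensor₂ hT hy a 1
  rw [Matrix.trace_fin_two] at t0 t1
  rw [Fin.sum_univ_two] at h0 h1
  rw [← t0, ← t1]
  obtain rfl | rfl : k = 0 ∨ k = 1 := by omega
  · simp
    linear_combination h1
  · simp
    linear_combination -h0

/-- The rough Laplacian of a symmetric divergence-free tensor on a surface. -/
theorem traceCovTensor₂_eq (hG : IsMetricOn G U) (hT : ∀ z ∈ U, SmoothMatAt T z)
    (hs : ∀ z ∈ U, G z * T z = (T z)ᵀ * G z) (hdiv : ∀ z ∈ U, divTensor G T z = 0)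
    (hy : y ∈ U) :
    traceCovTensor₂ G T y =
      (2 * gaussCurvature G y) • T y
        - ((T y).trace * gaussCurvature G y) • (1 : Matrix (Fin 2) (Fin 2) ℝ)
        - laplacian G (fun z => (T z).trace) y • (1 : Matrix (Fin 2) (Fin 2) ℝ)
        - nablaGrad G (fun z => (T z).trace) y := by
  have ht : ContDiffAt ℝ ∞ (fun z => (T z).trace) y := (hT y hy).trace
  -- The derivative of div T again, now contracted with the inverse metric over the last derivative
  -- index and the lower index of T.
  have hraise : ∀ a k, ∑ i, ∑ j, (G y)⁻¹ i j * covTensor₂ G T a i y k j = 0 := fun a k => by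
    rw [hG.sum_inv_mul_apply hy (fun i => hG.covTensor₂_symm hT hs hy a i)]
    simp [hG.sum_covTensor₂_eq_zero hT hs hdiv hy]
  have hcod := hG.covTensor₂_codazzi hT hs hdiv hy
  have hcurv := fun k j => congrFun (congrFun (hG.curvMat_commutator hy (hs y hy)) k) j
  rw [← hG.covTensor₂_comm hy (hT y hy) 0 1] at hcurv
  have hgs := hG.inv_symm_apply hy 0 1
  have hhs := hG.hess_symm hy ht 0 1
  ext k j
  simp only [traceCovTensor₂, Matrix.sum_apply, Matrix.sub_apply, Matrix.smul_apply, smul_eq_mul,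
    hG.nablaGrad_apply hy ht, hG.laplacian_eq hy ht, Fin.sum_univ_two]
  simp only [Matrix.mul_apply, Matrix.sub_apply, Fin.sum_univ_two, Matrix.smul_apply,
    smul_eq_mul, Matrix.transpose_apply] at hcurv hcod hraise
  rw [Matrix.trace_fin_two]
  obtain rfl | rfl : j = 0 ∨ j = 1 := by omega
  · have c1 := hcurv k 1
    have r0 := hraise 0 k
    have d0 := hcod 0 k
    have d1 := hcod 1 k
    obtain rfl | rfl : k = 0 ∨ k = 1 := by omega
    all_goals simp [hgs, ← hhs] at c1 r0 d0 d1 ⊢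
    all_goals
      -- Start from the vanishing contraction, exchange the tensor index by Codazzi (`d0`, `d1`),
      -- then the derivatives by the Ricci identity. Only the column of the raised commutator with
      -- index other than j enters (`c1`).
      linear_combination r0 - (G y)⁻¹ 1 0 * d0 - (G y)⁻¹ 1 1 * d1 - c1
  · have c1 := hcurv k 0
    have r0 := hraise 1 k
    have d0 := hcod 0 k
    have d1 := hcod 1 k
    obtain rfl | rfl : k = 0 ∨ k = 1 := by omega
    all_goals simp [hgs, ← hhs] at c1 r0 d0 d1 ⊢
    all_goals
      linear_combination r0 + (G y)⁻¹ 0 0 * d0 + (G y)⁻¹ 1 0 * d1 + c1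

end IsMetricOn

/-! ### A Bochner formula for symmetric divergence-free tensors -/

/-- Leibniz rule with covariant derivatives: the connection contributes [Γ_i, AB], which is
traceless. -/
theorem pd_trace_mul {m : ℕ} {A B : MatrixField m} {y : Coord m} (G : MatrixField m) (i : Fin m)
    (hA : SmoothMatAt A y) (hB : SmoothMatAt B y) :
    pd i (fun z => (A z * B z).trace) y =
      (covTensor G A i y * B y + A y * covTensor G B i y).trace := by
  rw [pd_trace i (hA.mul hB), pdMat_mul i hA hB, covTensor_eq, covTensor_eq]
  have h : (pdMat i A y + (connMat G i y * A y - A y * connMat G i y)) * B y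
      + A y * (pdMat i B y + (connMat G i y * B y - B y * connMat G i y))
      = (pdMat i A y * B y + A y * pdMat i B y)
        + (connMat G i y * (A y * B y) - (A y * B y) * connMat G i y) := by
    noncomm_ring
  rw [h, Matrix.trace_add _ (_ - _), Matrix.trace_sub, Matrix.trace_mul_comm (connMat G i y),
    sub_self, add_zero]

namespace IsMetricOn

variable {m : ℕ} {G : MatrixField m} {U : Set (Coord m)} {y : Coord m} {T : MatrixField m}
  {f t : Coord m → ℝ}

/-- In general ⟨A, B⟩ is the trace of the adjoint of A times B; here A is its own adjoint. -/
theorem tensorInner_eq_trace (hG : IsMetricOn G U) (hy : y ∈ U) {A : Matrix (Fin m) (Fin m) ℝ}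
    (h : G y * A = Aᵀ * G y) (B : Matrix (Fin m) (Fin m) ℝ) :
    tensorInner G y A B = (A * B).trace := by
  have h1 : G y * (A * (G y)⁻¹) = Aᵀ := by
    rw [← mul_assoc, h, Matrix.mul_nonsing_inv_cancel_right _ _ (hG.det y hy)]
  have h2 : tensorInner G y A B = ∑ j, ∑ l, (G y * (A * (G y)⁻¹)) l j * B l j := by
    simp only [tensorInner, Matrix.mul_apply, Finset.mul_sum, Finset.sum_mul]
    rw [Finset.sum_comm]
    refine Finset.sum_congr rfl fun j _ => ?_
    rw [Finset.sum_comm_cycle]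
    refine Finset.sum_congr rfl fun l _ => ?_
    rw [Finset.sum_comm]
    refine Finset.sum_congr rfl fun k _ => Finset.sum_congr rfl fun i _ => ?_
    rw [hG.symm_apply hy k l]
    ring
  rw [h2, h1]
  rfl

theorem hess_congr (hG : IsMetricOn G U) (hy : y ∈ U) (h : ∀ z ∈ U, f z = t z) (i j : Fin m) :
    hess G f i j y = hess G t i j y := by
  have h1 : ∀ p, ∀ z ∈ U, pd p f z = pd p t z :=
    fun p z hz => pd_congr (hG.eventually_of_forall h hz)
  simp only [hess, h1 _ y hy, pd_congr (hG.eventually_of_forall (h1 j) hy)]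

theorem hess_sq (hf : ContDiffAt ℝ ∞ f y) (i j : Fin m) :
    hess G (fun z => f z ^ 2) i j y = 2 * f y * hess G f i j y + 2 * (pd i f y * pd j f y) := by
  have h1 : ∀ p z, DifferentiableAt ℝ f z → pd p (fun z => f z ^ 2) z = 2 * (f z * pd p f z) :=
    fun p z hz => by
      simp only [pow_two, pd_mul (i := p) hz hz]
      ring
  have hd := hf.differentiableAt_infty
  have hev : ∀ᶠ z in 𝓝 y, DifferentiableAt ℝ f z :=
    ((hf.of_le (m := 1) (by simp)).eventually (by simp)).mono
      fun z hz => hz.differentiableAt (by simp)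
  have hj := (hf.pd j).differentiableAt_infty
  have h2 : pd i (fun z => 2 * (f z * pd j f z)) y
      = 2 * (pd i f y * pd j f y + f y * pd i (fun z => pd j f z) y) := by
    rw [pd_mul (by fun_prop) (hd.fun_mul hj), pd_const, pd_mul hd hj]
    ring
  rw [hess, pd_congr (hev.mono (h1 j)), h2]
  have h3 : ∑ p, christoffel G p i j y * (2 * (f y * pd p f y))
      = 2 * f y * ∑ p, christoffel G p i j y * pd p f y := by
    rw [Finset.mul_sum]
    exact Finset.sum_congr rfl fun p _ => by ring
  simp only [h1 _ y hd, hess, h3]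
  ring

theorem laplacian_sq (hG : IsMetricOn G U) (hy : y ∈ U) (hf : ContDiffAt ℝ ∞ f y) :
    laplacian G (fun z => f z ^ 2) y = 2 * f y * laplacian G f y
      - 2 * ∑ i, ∑ j, (G y)⁻¹ i j * (pd i f y * pd j f y) := by
  rw [hG.laplacian_eq hy (hf.pow 2), hG.laplacian_eq hy hf]
  simp only [hess_sq hf, mul_add, Finset.sum_add_distrib, Finset.mul_sum, mul_neg]
  have : ∀ i j, (G y)⁻¹ i j * (2 * f y * hess G f i j y)
    = 2 * f y * ((G y)⁻¹ i j * hess G f i j y) := fun i j => by ring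
  simp only [this, mul_left_comm (2 : ℝ)]
  ring

theorem vecNormSq_grad (hG : IsMetricOn G U) (hy : y ∈ U) (f : Coord m → ℝ) :
    vecNormSq G y (grad G f y) = ∑ i, ∑ j, (G y)⁻¹ i j * (pd i f y * pd j f y) := by
  have h : ∀ i, ∑ j, G y i j * grad G f y j = pd i f y := fun i => by
    have : G y *ᵥ ((G y)⁻¹ *ᵥ fun j => pd j f y) = fun j => pd j f y := by
      rw [Matrix.mulVec_mulVec, Matrix.mul_nonsing_inv _ (hG.det y hy), Matrix.one_mulVec]
    exact congrFun this i
  have h2 : vecNormSq G y (grad G f y) = ∑ i, grad G f y i * ∑ j, G y i j * grad G f y j := by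
    simp only [vecNormSq, Finset.mul_sum]
    exact Finset.sum_congr rfl fun i _ => Finset.sum_congr rfl fun j _ => by ring
  simp only [h2, h]
  simp only [grad, Finset.sum_mul]
  exact Finset.sum_congr rfl fun i _ => Finset.sum_congr rfl fun j _ => by ring

/-- Two uses of the covariant Leibniz rule; the correction term of the Hessian is exactly the one in
`covTensor₂`. -/
theorem hess_trace_sq (hG : IsMetricOn G U) (hT : ∀ z ∈ U, SmoothMatAt T z) (hy : y ∈ U)
    (i j : Fin m) :
    hess G (fun z => (T z * T z).trace) i j y = 2 * (covTensor₂ G T i j y * T y).trace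
      + 2 * (covTensor G T i y * covTensor G T j y).trace := by
  have h1 : ∀ p, ∀ z ∈ U, pd p (fun z => (T z * T z).trace) z
      = 2 * (covTensor G T p z * T z).trace := fun p z hz => by
    rw [pd_trace_mul G p (hT z hz) (hT z hz), Matrix.trace_add, Matrix.trace_mul_comm (T z)]
    ring
  have hD := hG.smooth_covTensor hy (hT y hy) j
  have h2 : pd i (fun z => 2 * (covTensor G T j z * T z).trace) y
      = 2 * pd i (fun z => (covTensor G T j z * T z).trace) y := by
    rw [pd_mul (by fun_prop) (hD.mul (hT y hy)).trace.differentiableAt_infty, pd_const]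
    ring
  rw [hess, pd_congr (hG.eventually_of_forall (h1 j) hy), h2, pd_trace_mul G i hD (hT y hy)]
  simp only [h1 _ y hy, covTensor₂, sub_mul, Matrix.trace_sub, Matrix.trace_add, Finset.sum_mul,
    Matrix.trace_sum, Matrix.smul_mul, Matrix.trace_smul, smul_eq_mul, mul_sub, mul_add,
    Finset.mul_sum, mul_left_comm (2 : ℝ)]
  rw [Matrix.trace_mul_comm (covTensor G T j y)]
  ring

/-- The Bochner formula for symmetric tensors of type `(1,1)`. -/
theorem half_laplacian_tensorInner (hG : IsMetricOn G U) (hT : ∀ z ∈ U, SmoothMatAt T z)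
    (hs : ∀ z ∈ U, G z * T z = (T z)ᵀ * G z) (hy : y ∈ U) :
    (1 / 2) * laplacian G (fun z => tensorInner G z (T z) (T z)) y =
      - (traceCovTensor₂ G T y * T y).trace - covTensorNormSq G T y := by
  have h1 : ∀ z ∈ U, tensorInner G z (T z) (T z) = (T z * T z).trace :=
    fun z hz => hG.tensorInner_eq_trace hz (hs z hz) _
  have hsm : ContDiffAt ℝ ∞ (fun z => (T z * T z).trace) y := ((hT y hy).mul (hT y hy)).trace
  rw [hG.laplacian_eq hy (hsm.congr_of_eventuallyEq (hG.eventually_of_forall h1 hy))]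
  simp only [hG.hess_congr hy h1, hG.hess_trace_sq hT hy, traceCovTensor₂, covTensorNormSq,
    fun i => hG.tensorInner_eq_trace hy (hG.covTensor_symm hT hs hy i), Finset.sum_mul,
    Matrix.trace_sum, Matrix.smul_mul, Matrix.trace_smul, smul_eq_mul, mul_add,
    Finset.sum_add_distrib, mul_left_comm _ (2 : ℝ), ← Finset.mul_sum]
  ring

/-- `div ⟨T, grad f⟩^♯ = ⟨T, ∇ grad f⟩` for symmetric divergence-free `T`. -/
theorem divVec_sharp_contraction (hG : IsMetricOn G U) (hT : ∀ z ∈ U, SmoothMatAt T z)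
    (hs : ∀ z ∈ U, G z * T z = (T z)ᵀ * G z) (hdiv : ∀ z ∈ U, divTensor G T z = 0) (hy : y ∈ U)
    (hf : ContDiffAt ℝ ∞ f y) :
    divVec G (sharp G (contraction G T (grad G f))) y = (T y * nablaGrad G f y).trace := by
  -- By symmetry of T the dual field is T(grad f).
  have h1 : ∀ z ∈ U, ∀ k, sharp G (contraction G T (grad G f)) z k
      = ∑ j, T z k j * grad G f z j := fun z hz k => by
    have h2 : contraction G T (grad G f) z = G z *ᵥ (T z *ᵥ grad G f z) := by
      ext j
      rw [Matrix.mulVec_mulVec, hs z hz]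
      simp only [contraction, Matrix.mulVec, dotProduct, Matrix.mul_apply, Finset.sum_mul,
        Matrix.transpose_apply]
      rw [Finset.sum_comm]
      exact Finset.sum_congr rfl fun i _ => Finset.sum_congr rfl fun j _ => by ring
    have h3 : sharp G (contraction G T (grad G f)) z
        = (G z)⁻¹ *ᵥ contraction G T (grad G f) z := rfl
    rw [h3, h2, Matrix.mulVec_mulVec, Matrix.nonsing_inv_mul _ (hG.det z hz), Matrix.one_mulVec]
    rfl
  -- Leibniz for T(grad f): summed over i, the first term pairs div T with grad f and vanishes.
  have h4 : ∀ i, covVec G (sharp G (contraction G T (grad G f))) i i y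
      = ∑ j, (covTensor G T i y i j * grad G f y j + T y i j * nablaGrad G f y j i) := fun i => by
    have hg : ∀ j, DifferentiableAt ℝ (fun z => grad G f z j) y :=
      fun j => (hG.smooth_grad hy hf j).differentiableAt_infty
    have hTd : ∀ j, DifferentiableAt ℝ (fun z => T z i j) y :=
      fun j => (hT y hy i j).differentiableAt_infty
    rw [covVec, pd_congr (hG.eventually_of_forall (fun z hz => h1 z hz i) hy),
      pd_sum fun j _ => (hTd j).fun_mul (hg j)]
    simp only [pd_mul (hTd _) (hg _), h1 y hy, covTensor_eq, nablaGrad, covVec, Matrix.add_apply,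
      Matrix.sub_apply, Matrix.of_apply, pdMat_apply, Matrix.mul_apply, connMat_apply, add_mul,
      sub_mul, mul_add, Finset.sum_add_distrib, Finset.sum_sub_distrib, Finset.mul_sum,
      Finset.sum_mul]
    rw [Finset.sum_comm (f := fun p j => christoffel G i i p y * (T y p j * grad G f y j)),
      Finset.sum_comm (f := fun j p => T y i j * (christoffel G j i p y * grad G f y p))]
    simp only [mul_assoc]
    ring
  simp only [divVec, h4, Finset.sum_add_distrib]
  rw [Finset.sum_comm]
  simp only [← Finset.sum_mul, hG.sum_covTensor_eq_zero hT hs hdiv hy, zero_mul,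
    Finset.sum_const_zero, zero_add]
  rfl

end IsMetricOn

/-- A Simons type formula for symmetric divergence-free tensors on surfaces. -/
theorem IsMetricOn.simons {G T : MatrixField 2} {U : Set (Coord 2)} {y : Coord 2}
    {t : Coord 2 → ℝ} (hG : IsMetricOn G U) (hT : ∀ z ∈ U, SmoothMatAt T z)
    (hs : ∀ z ∈ U, G z * T z = (T z)ᵀ * G z) (hdiv : ∀ z ∈ U, divTensor G T z = 0)
    (ht : ∀ z ∈ U, (T z).trace = t z) (hy : y ∈ U) :
    (1 / 2) * laplacian G (fun z => tensorInner G z (T z) (T z)) y =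
      - 2 * gaussCurvature G y * tensorInner G y (T y) (T y)
        + divVec G (sharp G (contraction G T (grad G t))) y
        + gaussCurvature G y * t y ^ 2
        + (1 / 2) * laplacian G (fun z => t z ^ 2) y
        + vecNormSq G y (grad G t y)
        - covTensorNormSq G T y := by
  have hst : ContDiffAt ℝ ∞ (fun z => (T z).trace) y := (hT y hy).trace
  have hst' : ContDiffAt ℝ ∞ t y := hst.congr_of_eventuallyEq
    (hG.eventually_of_forall (fun z hz => (ht z hz).symm) hy)
  -- The trace agrees with t only on the open set U, which suffices for its derivatives at y.
  have hlap : laplacian G (fun z => (T z).trace) y = laplacian G t y := by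
    simp only [hG.laplacian_eq hy hst, hG.laplacian_eq hy hst', hG.hess_congr hy ht]
  have hnab : nablaGrad G (fun z => (T z).trace) y = nablaGrad G t y := by
    ext k j
    simp only [hG.nablaGrad_apply hy hst, hG.nablaGrad_apply hy hst', hG.hess_congr hy ht]
  rw [hG.half_laplacian_tensorInner hT hs hy, hG.traceCovTensor₂_eq hT hs hdiv hy,
    hG.divVec_sharp_contraction hT hs hdiv hy hst', hG.laplacian_sq hy hst',
    hG.vecNormSq_grad hy, hG.tensorInner_eq_trace hy (hs y hy), hlap, hnab, ht y hy]
  simp only [sub_mul, Matrix.trace_sub, Matrix.smul_mul, Matrix.trace_smul, smul_eq_mul, one_mul,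
    ht y hy, Matrix.trace_mul_comm (T y) (nablaGrad G t y)]
  ring

/-! ### Metrics and tensor fields in a chart -/

section Charts

variable {m n : ℕ}
  {M : Type*} [TopologicalSpace M] [ChartedSpace (EuclideanSpace ℝ (Fin m)) M]
  {N : Type*} [TopologicalSpace N] [ChartedSpace (EuclideanSpace ℝ (Fin n)) N]

/-- The image of a smooth vector field along a map under a smooth map. -/
theorem contMDiffAt_mfderiv_apply [IsManifold (𝓡 m) 1 M] [IsManifold (𝓡 n) 1 N] {p : ℕ}
    {b : Coord p → M} {v : ∀ y, TangentSpace (𝓡 m) (b y)} {f : M → N} {y : Coord p}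
    (hf : ContMDiffAt (𝓡 m) (𝓡 n) ∞ f (b y)) (hb : ContMDiffAt (𝓡 p) (𝓡 m) ∞ b y)
    (hv : ContMDiffAt (𝓡 p) ((𝓡 m).prod (𝓡 m)) ∞
      (fun z => TotalSpace.mk' (EuclideanSpace ℝ (Fin m)) (E := TangentSpace (𝓡 m)) (b z) (v z)) y) :
    ContMDiffAt (𝓡 p) ((𝓡 n).prod (𝓡 n)) ∞
      (fun z => TotalSpace.mk' (EuclideanSpace ℝ (Fin n)) (E := TangentSpace (𝓡 n)) (f (b z))
        (mfderiv (𝓡 m) (𝓡 n) f (b z) (v z))) y := by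
  have h := (ContMDiffAt.mfderiv_const (m := ∞) hf (by simp)).comp y hb
  exact ContMDiffAt.clm_apply_of_inCoordinates (b₁ := b) (b₂ := fun z => f (b z)) h hv
    (hf.comp y hb)

theorem mdifferentiable_of_mem_maximalAtlas
    {e : OpenPartialHomeomorph M (EuclideanSpace ℝ (Fin m))}
    (he : e ∈ IsManifold.maximalAtlas (𝓡 m) ∞ M) :
    e.MDifferentiable (𝓡 m) (𝓡 m) :=
  ⟨(contMDiffOn_of_mem_maximalAtlas he).mdifferentiableOn (by simp),
    (contMDiffOn_symm_of_mem_maximalAtlas he).mdifferentiableOn (by simp)⟩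

variable {e : OpenPartialHomeomorph M (EuclideanSpace ℝ (Fin m))} {y : Coord m}

theorem mfderiv_symm_apply_eq_sum (w : EuclideanSpace ℝ (Fin m)) :
    mfderiv (𝓡 m) (𝓡 m) e.symm y w = ∑ k, w k • coordVec e y k := by
  have hw : w = ∑ k, w k • (EuclideanSpace.single k (1 : ℝ) : EuclideanSpace ℝ (Fin m)) := by
    ext j
    simp [Finset.sum_apply, Pi.single_apply]
  have h : mfderiv (𝓡 m) (𝓡 m) e.symm y (∑ k, w k • (EuclideanSpace.single k (1 : ℝ) :
      EuclideanSpace ℝ (Fin m))) = ∑ k, w k • coordVec e y k :=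
    (map_sum _ _ _).trans (Finset.sum_congr rfl fun k _ => map_smul _ _ _)
  exact (congrArg (fun w : EuclideanSpace ℝ (Fin m) => mfderiv (𝓡 m) (𝓡 m) e.symm y w) hw).trans h

/-- Linear independence of the coordinate fields, from injectivity of the derivative of the inverse
chart. -/
theorem eq_zero_of_sum_smul_coordVec (he : e ∈ IsManifold.maximalAtlas (𝓡 m) ∞ M)
    (hy : y ∈ e.target) {c : Fin m → ℝ} (h : ∑ i, c i • coordVec e y i = 0) : c = 0 := by
  have h1 := mfderiv_symm_apply_eq_sum (e := e) (y := y) (WithLp.toLp 2 c)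
  have h2 : mfderiv (𝓡 m) (𝓡 m) e.symm y (WithLp.toLp 2 c) = 0 := h1.trans h
  have h3 := (mdifferentiable_of_mem_maximalAtlas he).symm.mfderiv_injective hy
    (h2.trans (map_zero _).symm)
  exact congrArg WithLp.ofLp h3

variable [IsManifold (𝓡 m) ∞ M]

theorem contMDiffAt_coordVec (he : e ∈ IsManifold.maximalAtlas (𝓡 m) ∞ M) (hy : y ∈ e.target)
    (i : Fin m) :
    ContMDiffAt (𝓡 m) ((𝓡 m).prod (𝓡 m)) ∞
      (fun z => TotalSpace.mk' (EuclideanSpace ℝ (Fin m)) (E := TangentSpace (𝓡 m)) (e.symm z)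
        (coordVec e z i)) y := by
  have : IsManifold (𝓡 m) 1 M := IsManifold.of_le (n := ∞) (by simp)
  refine contMDiffAt_mfderiv_apply (b := fun z : Coord m => z) (f := e.symm)
    (v := fun _ => (EuclideanSpace.single i (1 : ℝ) : EuclideanSpace ℝ (Fin m)))
    (contMDiffAt_symm_of_mem_maximalAtlas he hy) contMDiffAt_id ?_
  exact contMDiffAt_vectorSpace_iff_contDiffAt.2 contDiffAt_const

theorem smoothMatAt_metricInChart (g : RiemMetric m M)
    (he : e ∈ IsManifold.maximalAtlas (𝓡 m) ∞ M) (hy : y ∈ e.target) :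
    SmoothMatAt (metricInChart g e) y := by
  intro i j
  have hs : ContMDiffAt (𝓡 m) (𝓡 m) ∞ e.symm y := contMDiffAt_symm_of_mem_maximalAtlas he hy
  have h := ContMDiffAt.clm_bundle_apply₂ (F₁ := EuclideanSpace ℝ (Fin m))
    (F₂ := EuclideanSpace ℝ (Fin m)) (F₃ := ℝ) (E₃ := Trivial M ℝ)
    (b := e.symm) (ψ := fun z => g.inner (e.symm z))
    ((g.contMDiff _).comp y hs) (contMDiffAt_coordVec he hy i) (contMDiffAt_coordVec he hy j)
  rw [contMDiffAt_totalSpace] at h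
  exact contMDiffAt_iff_contDiffAt.1 h.2

theorem smoothMatAt_tensorInChart (T : EndField m M)
    (he : e ∈ IsManifold.maximalAtlas (𝓡 m) ∞ M) (hy : y ∈ e.target) :
    SmoothMatAt (tensorInChart T e) y := by
  have : IsManifold (𝓡 m) 1 M := IsManifold.of_le (n := ∞) (by simp)
  intro k j
  have hs : ContMDiffAt (𝓡 m) (𝓡 m) ∞ e.symm y := contMDiffAt_symm_of_mem_maximalAtlas he hy
  have h := ContMDiffAt.clm_bundle_apply (F₁ := EuclideanSpace ℝ (Fin m))
    (F₂ := EuclideanSpace ℝ (Fin m)) (b := e.symm) (ϕ := fun z => T (e.symm z))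
    ((T.contMDiff _).comp y hs) (contMDiffAt_coordVec he hy j)
  -- Pushing T(∂_j) forward by the chart lands in the trivial tangent bundle of the model, where
  -- components can be read off.
  have h2 := contMDiffAt_mfderiv_apply (f := e)
    (contMDiffAt_of_mem_maximalAtlas he (e.map_target hy)) hs h
  have h3 := contMDiffAt_iff_contDiffAt.1
    ((contMDiff_snd_tangentBundle_modelSpace _ _).contMDiffAt.comp y h2)
  exact (EuclideanSpace.proj (𝕜 := ℝ) k).contDiff.contDiffAt.comp y h3

/-- A tensor applied to a coordinate vector field expands in the coordinate vector fields. -/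
theorem tensor_coordVec (T : EndField m M) (he : e ∈ IsManifold.maximalAtlas (𝓡 m) ∞ M)
    (hy : y ∈ e.target) (j : Fin m) :
    T (e.symm y) (coordVec e y j) = ∑ k, tensorInChart T e y k j • coordVec e y k := by
  have h := (mdifferentiable_of_mem_maximalAtlas he).symm_comp_deriv (e.map_target hy)
  rw [e.right_inv hy] at h
  have h1 := congrArg (fun L => L (T (e.symm y) (coordVec e y j))) h
  exact h1.symm.trans (mfderiv_symm_apply_eq_sum _)

theorem isMetricOn_metricInChart (g : RiemMetric m M)
    (he : e ∈ IsManifold.maximalAtlas (𝓡 m) ∞ M) :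
    IsMetricOn (metricInChart g e) e.target where
  isOpen := e.open_target
  smooth _ hy := smoothMatAt_metricInChart g he hy
  symm y _ := by
    ext i j
    exact g.symm _ _ _
  det y hy := by
    rw [isUnit_iff_ne_zero]
    intro h
    -- A kernel vector of the Gram matrix would give a tangent vector of length zero, hence a linear
    -- relation between the coordinate fields.
    obtain ⟨c, hc, h0⟩ := Matrix.exists_mulVec_eq_zero_iff.2 h
    have h1 : g.inner (e.symm y) (∑ i, c i • coordVec e y i) (∑ i, c i • coordVec e y i) = 0 := by
      have : c ⬝ᵥ (metricInChart g e y *ᵥ c) = 0 := by rw [h0, dotProduct_zero]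
      rw [← this]
      simp only [map_sum, map_smul, sum_apply, smul_apply, smul_eq_mul, dotProduct, Matrix.mulVec,
        metricInChart, Matrix.of_apply, Finset.mul_sum]
      rw [Finset.sum_comm]
      exact Finset.sum_congr rfl fun i _ => Finset.sum_congr rfl fun j _ => by ring
    refine hc (eq_zero_of_sum_smul_coordVec he hy ?_)
    by_contra hne
    exact (g.pos _ _ hne).ne' h1

theorem metricInChart_mul_tensorInChart {g : RiemMetric m M} {T : EndField m M}
    (hT : IsSymmetricField g T) (he : e ∈ IsManifold.maximalAtlas (𝓡 m) ∞ M) (hy : y ∈ e.target) :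
    metricInChart g e y * tensorInChart T e y = (tensorInChart T e y)ᵀ * metricInChart g e y := by
  have h1 : ∀ i j, (metricInChart g e y * tensorInChart T e y) i j
      = g.inner (e.symm y) (coordVec e y i) (T (e.symm y) (coordVec e y j)) := fun i j => by
    conv_rhs => rw [tensor_coordVec T he hy j]
    simp only [map_sum, map_smul, smul_eq_mul, Matrix.mul_apply]
    exact Finset.sum_congr rfl fun k _ => mul_comm _ _
  have h2 : (tensorInChart T e y)ᵀ * metricInChart g e y
      = (metricInChart g e y * tensorInChart T e y)ᵀ := by
    rw [Matrix.transpose_mul, (isMetricOn_metricInChart g he).symm y hy]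
  rw [h2]
  ext i j
  rw [Matrix.transpose_apply, h1, h1, ← hT, g.symm]

end Charts

/-! ### The stress-bienergy tensor in charts -/

section StressBienergy

variable {m n : ℕ} {G : MatrixField m} {H : MatrixField n} {U : Set (Coord m)}
  {V : Set (Coord n)} {f : Coord m → Coord n} {y : Coord m}

theorem contDiffAt_covAlong (hH : IsMetricOn H V) (hf : ContDiffAt ℝ ∞ f y) (hfy : f y ∈ V)
    {W : Coord m → Fin n → ℝ} (hW : ∀ a, ContDiffAt ℝ ∞ (fun z => W z a) y) (i : Fin m)
    (a : Fin n) : ContDiffAt ℝ ∞ (fun z => covAlong H f W i z a) y := by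
  have hfa : ∀ a, ContDiffAt ℝ ∞ (fun z => f z a) y :=
    fun a => (EuclideanSpace.proj (𝕜 := ℝ) a).contDiff.contDiffAt.comp y hf
  unfold covAlong
  exact ((hW a).pd i).add (ContDiffAt.sum fun b _ => ContDiffAt.sum fun c _ =>
    (((hH.smooth_christoffel hfy a b c).comp y hf).mul ((hfa b).pd i)).mul (hW c))

theorem contDiffAt_tension (hG : IsMetricOn G U) (hy : y ∈ U) (hH : IsMetricOn H V)
    (hf : ContDiffAt ℝ ∞ f y) (hfy : f y ∈ V) (a : Fin n) :
    ContDiffAt ℝ ∞ (fun z => tension G H f z a) y := by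
  have hfa : ∀ a, ContDiffAt ℝ ∞ (fun z => f z a) y :=
    fun a => (EuclideanSpace.proj (𝕜 := ℝ) a).contDiff.contDiffAt.comp y hf
  unfold tension secondFundamentalForm
  exact ContDiffAt.sum fun i _ => ContDiffAt.sum fun j _ => (hG.smooth_inv hy i j).mul
    ((contDiffAt_covAlong hH hf hfy (fun c => (hfa c).pd j) i a).sub
      (ContDiffAt.sum fun k _ => (hG.smooth_christoffel hy k i j).mul ((hfa a).pd k)))

theorem contDiffAt_innerDfNablaTension (hG : IsMetricOn G U) (hy : y ∈ U) (hH : IsMetricOn H V)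
    (hf : ContDiffAt ℝ ∞ f y) (hfy : f y ∈ V) (i j : Fin m) :
    ContDiffAt ℝ ∞ (fun z => innerDfNablaTension G H f i j z) y := by
  have hfa : ∀ a, ContDiffAt ℝ ∞ (fun z => f z a) y :=
    fun a => (EuclideanSpace.proj (𝕜 := ℝ) a).contDiff.contDiffAt.comp y hf
  unfold innerDfNablaTension
  exact ContDiffAt.sum fun a _ => ContDiffAt.sum fun b _ =>
    (((hH.smooth _ hfy a b).comp y hf).mul ((hfa a).pd i)).mul
      (contDiffAt_covAlong hH hf hfy (contDiffAt_tension hG hy hH hf hfy) j b)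

theorem smoothMatAt_stressBienergy (hG : IsMetricOn G U) (hy : y ∈ U) (hH : IsMetricOn H V)
    (hf : ContDiffAt ℝ ∞ f y) (hfy : f y ∈ V) : SmoothMatAt (stressBienergy G H f) y := by
  intro k j
  have hi := contDiffAt_innerDfNablaTension hG hy hH hf hfy
  have ht := contDiffAt_tension hG hy hH hf hfy
  have hsq : ContDiffAt ℝ ∞ (fun z => tensionNormSq G H f z) y := by
    unfold tensionNormSq vecNormSq
    exact ContDiffAt.sum fun a _ => ContDiffAt.sum fun b _ =>
      (((hH.smooth _ hfy a b).comp y hf).mul (ht a)).mul (ht b)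
  simp only [stressBienergy, stressBienergyForm, Matrix.of_apply]
  exact ContDiffAt.sum fun i _ => (hG.smooth_inv hy k i).mul
    (((((contDiffAt_const.mul hsq).mul (hG.smooth y hy j i)).add
      ((ContDiffAt.sum fun k _ => ContDiffAt.sum fun l _ =>
        (hG.smooth_inv hy k l).mul (hi k l)).mul (hG.smooth y hy j i))).sub (hi j i)).sub (hi i j))

theorem mul_stressBienergy_apply (hG : IsMetricOn G U) (hy : y ∈ U) (k j : Fin m) :
    (G y * stressBienergy G H f y) k j = stressBienergyForm G H f j k y := by
  have : stressBienergy G H f y = (G y)⁻¹ * Matrix.of fun i j => stressBienergyForm G H f j i y :=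
    rfl
  rw [this, Matrix.mul_nonsing_inv_cancel_left _ _ (hG.det y hy)]
  rfl

theorem mul_stressBienergy_symm (hG : IsMetricOn G U) (hy : y ∈ U) :
    G y * stressBienergy G H f y = (stressBienergy G H f y)ᵀ * G y := by
  have h2 : (stressBienergy G H f y)ᵀ * G y = (G y * stressBienergy G H f y)ᵀ := by
    rw [Matrix.transpose_mul, hG.symm y hy]
  rw [h2]
  ext i j
  rw [Matrix.transpose_apply, mul_stressBienergy_apply hG hy, mul_stressBienergy_apply hG hy]
  simp only [stressBienergyForm, hG.symm_apply hy i j]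
  ring

/-- As the identity has trace 2, the first term contributes |τ|², and 2⟨df, ∇τ⟩ cancels the traces
of the last two terms. -/
theorem trace_stressBienergy {G : MatrixField 2} {U : Set (Coord 2)} {y : Coord 2}
    {f : Coord 2 → Coord n} (hG : IsMetricOn G U) (hy : y ∈ U) :
    (stressBienergy G H f y).trace = tensionNormSq G H f y := by
  have h := fun i => congrFun (congrFun (Matrix.nonsing_inv_mul _ (hG.det y hy)) i) i
  have h0 := h 0
  have h1 := h 1
  simp only [Matrix.mul_apply, Fin.sum_univ_two, Matrix.one_apply_eq] at h0 h1
  rw [Matrix.trace_fin_two]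
  simp only [stressBienergy, stressBienergyForm, Matrix.of_apply, Fin.sum_univ_two]
  simp only [hG.symm_apply hy 0 1, hG.inv_symm_apply hy 0 1] at h0 h1 ⊢
  -- The sum `h0 + h1` is trace(G⁻¹ G) = 2; its coefficient is the factor multiplying the metric in
  -- S₂.
  linear_combination ((1 / 2) * tensionNormSq G H f y
    + ((G y)⁻¹ 0 0 * innerDfNablaTension G H f 0 0 y
      + (G y)⁻¹ 1 0 * innerDfNablaTension G H f 0 1 y
      + ((G y)⁻¹ 1 0 * innerDfNablaTension G H f 1 0 y
        + (G y)⁻¹ 1 1 * innerDfNablaTension G H f 1 1 y))) * (h0 + h1)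

end StressBienergy

end Biconservative

end

theorem mainTheorem7 {n : ℕ}
    {M : Type*} [TopologicalSpace M] [ChartedSpace (EuclideanSpace ℝ (Fin 2)) M]
    [IsManifold (𝓡 2) ∞ M]
    {N : Type*} [TopologicalSpace N] [ChartedSpace (EuclideanSpace ℝ (Fin n)) N]
    [IsManifold (𝓡 n) ∞ N]
    (g : Biconservative.RiemMetric 2 M) (h : Biconservative.RiemMetric n N) :
    -- `trace ∇²T = 2 K T - t K I - (Δ t) I - ∇ grad t`, in every chart `e`
    (∀ T : Biconservative.EndField 2 M,
      Biconservative.IsSymmetricField g T → Biconservative.IsDivergenceFree g T →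
      ∀ e ∈ IsManifold.maximalAtlas (𝓡 2) ∞ M, ∀ p ∈ e.source,
        let G := Biconservative.metricInChart g e
        let A := Biconservative.tensorInChart T e
        let t : Biconservative.Coord 2 → ℝ := fun y => (A y).trace
        let K := Biconservative.gaussCurvature G
        Biconservative.traceCovTensor₂ G A (e p) =
          (2 * K (e p)) • A (e p) - (t (e p) * K (e p)) • (1 : Matrix (Fin 2) (Fin 2) ℝ)
            - Biconservative.laplacian G t (e p) • (1 : Matrix (Fin 2) (Fin 2) ℝ)
            - Biconservative.nablaGrad G t (e p)) ∧
    -- the Simons type formula for `S₂`, in all charts `e` and `e'`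
    (∀ φ : M → N, Biconservative.IsBiconservative g h φ →
      ∀ e ∈ IsManifold.maximalAtlas (𝓡 2) ∞ M, ∀ e' ∈ IsManifold.maximalAtlas (𝓡 n) ∞ N,
      ∀ p ∈ e.source, φ p ∈ e'.source →
        let G := Biconservative.metricInChart g e
        let H := Biconservative.metricInChart h e'
        let f := Biconservative.mapInCharts φ e e'
        let S₂ := Biconservative.stressBienergy G H f
        let τsq : Biconservative.Coord 2 → ℝ := Biconservative.tensionNormSq G H f
        let K := Biconservative.gaussCurvature G
        (1 / 2) * Biconservative.laplacian G
            (fun y => Biconservative.tensorInner G y (S₂ y) (S₂ y)) (e p) =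
          - 2 * K (e p) * Biconservative.tensorInner G (e p) (S₂ (e p)) (S₂ (e p))
          + Biconservative.divVec G
              (Biconservative.sharp G
                (Biconservative.contraction G S₂ (Biconservative.grad G τsq))) (e p)
          + K (e p) * τsq (e p) ^ 2
          + (1 / 2) * Biconservative.laplacian G (fun y => τsq y ^ 2) (e p)
          + Biconservative.vecNormSq G (e p) (Biconservative.grad G τsq (e p))
          - Biconservative.covTensorNormSq G S₂ (e p)) := by
  refine ⟨fun T hT hdiv e he p hp => ?_, fun φ hφ e he e' he' p hp hp' => ?_⟩
  · have hdiv' : ∀ z ∈ e.target, Biconservative.divTensor (Biconservative.metricInChart g e)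
        (Biconservative.tensorInChart T e) z = 0 := fun z hz => by
      have := hdiv e he (e.symm z) (e.map_target hz)
      rwa [e.right_inv hz] at this
    exact (Biconservative.isMetricOn_metricInChart g he).traceCovTensor₂_eq
      (fun z hz => Biconservative.smoothMatAt_tensorInChart T he hz)
      (fun z hz => Biconservative.metricInChart_mul_tensorInChart hT he hz) hdiv'
      (e.map_source hp)
  -- The image of the whole chart `e` need not lie in `e'`, so the argument runs on the open part of
  -- the chart that φ maps into the source of `e'`.
  · have hU : IsOpen (e.target ∩ e.symm ⁻¹' (φ ⁻¹' e'.source)) :=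
      e.symm.isOpen_inter_preimage (e'.open_source.preimage hφ.1.1.continuous)
    have hG := (Biconservative.isMetricOn_metricInChart g he).mono hU Set.inter_subset_left
    have hH := Biconservative.isMetricOn_metricInChart h he'
    have hf : ∀ z ∈ e.target ∩ e.symm ⁻¹' (φ ⁻¹' e'.source),
        ContDiffAt ℝ ∞ (Biconservative.mapInCharts φ e e') z := fun z hz =>
      contMDiffAt_iff_contDiffAt.1 ((contMDiffAt_of_mem_maximalAtlas he' hz.2).comp z
        ((hφ.1.1 _).comp z (contMDiffAt_symm_of_mem_maximalAtlas he hz.1)))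
    refine hG.simons
      (fun z hz => Biconservative.smoothMatAt_stressBienergy hG hz hH (hf z hz)
        (e'.map_source hz.2))
      (fun z hz => Biconservative.mul_stressBienergy_symm hG hz) (fun z hz => ?_)
      (fun z hz => Biconservative.trace_stressBienergy hG hz) ⟨e.map_source hp, ?_⟩
    · have := hφ.2 e he e' he' (e.symm z) (e.map_target hz.1) hz.2
      rwa [e.right_inv hz.1] at this
    · rw [Set.mem_preimage, e.left_inv hp]
      exact hp'
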